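/- There is an absolute constant $C>0$ such that the following holds for every odd prime $p$, all integers $n\ge 1$ and $k\ge 0$. Let $X_n$ be a random symmetric $n\times n$ matrix over the ring $\mathbb{Z}_p$ of $p$-adic integers whose entries on and above the diagonal are independent and each distributed according to the Haar measure on $\mathbb{Z}_p$, normalised to have total mass $1$. Then, with $|\cdot|$ the $p$-adic absolute value ($|p|=p^{-1}$), $$\Bigl|\,\mathbb{P}\{|\det X_n| = p^{-k}\} - p^{-k}(1-p^{-n})\,\Bigr| \le C\,p^{-3k/2}.$$ In other words, $\mathbb{P}\{|\det X_n| = p^{-k}\} = p^{-k}(1-p^{-n}) + \mathcal{O}(p^{-3k/2})$, with the error term uniform in $n$. -/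

import Mathlib

open MeasureTheory ProbabilityTheory

/-- The Borel σ-algebra on the `p`-adic integers. -/
noncomputable instance PadicInt.instMeasurableSpaceBorel (p : ℕ) [Fact p.Prime] :
    MeasurableSpace ℤ_[p] := borel ℤ_[p]

instance PadicInt.instBorelSpaceBorel (p : ℕ) [Fact p.Prime] : BorelSpace ℤ_[p] := ⟨rfl⟩

/-- The additive Haar measure on `ℤ_[p]`, normalised so that the whole (compact) group
`ℤ_[p]` has mass `1`. -/
noncomputable def padicIntHaar (p : ℕ) [Fact p.Prime] : Measure ℤ_[p] :=
  Measure.addHaarMeasure ⊤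

instance padicIntHaar.instIsProbabilityMeasure (p : ℕ) [Fact p.Prime] :
    IsProbabilityMeasure (padicIntHaar p) :=
  ⟨by simpa [padicIntHaar] using
    Measure.addHaarMeasure_self (K₀ := (⊤ : TopologicalSpace.PositiveCompacts ℤ_[p]))⟩

/-- `X` is a random symmetric `n × n` matrix over `ℤ_[p]` whose entries on and above the diagonal
are independent, each distributed according to the normalised Haar measure on `ℤ_[p]`. -/
structure IsHaarSymmetricMatrix {Ω : Type*} [MeasurableSpace Ω] (P : Measure Ω)
    (p : ℕ) [Fact p.Prime] (n : ℕ) (X : Ω → Matrix (Fin n) (Fin n) ℤ_[p]) : Prop where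
  isSymm : ∀ ω, (X ω).IsSymm
  hasLaw : ∀ i j, i ≤ j → HasLaw (fun ω => X ω i j) (padicIntHaar p) P
  indep : iIndepFun
    (fun (e : {e : Fin n × Fin n // e.1 ≤ e.2}) (ω : Ω) => X ω e.1.1 e.1.2) P

/-! Write `r = 1/p`, and split a symmetric matrix into its corner `a`, its border `c` and the
complementary minor `Y`, so that `det = a * det Y - cᵀ adj(Y) c`. If `det Y ≠ 0` divides the form
`cᵀ adj(Y) c`, then, given `c` and `Y`, the quotient `det / det Y` is a translate of `a`, hence
Haar; otherwise the ultrametric inequality gives `det` the absolute value of the form. Haar measure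
on symmetric matrices is invariant under `Y ↦ g Y gᵀ` for invertible `g`, and a nonzero `c` is `p ^
j • g e₀`. Hence, given `‖c‖ = r ^ j`, the pair (|form|, |det Y|) has the law of (`r ^ (2j)` |corner
minor of `Y`|, |det Y|) (`borderHaar_norm_sq_eq`), and the recursion closes up. Let `Z n`, `A m` be
the generating functions of `detProb p n`, `minorProb p m`, and `G`, `H` those of a Haar integer and
(rescaled) of the border. Then `A (l+1) = Z (l+1) - X G H (A l)` and `Z (l+2) = G (A (l+1)) + H (A
l)`. A rational relation between `A l` and `Z (l+1)`, alternating with the parity of `l`, is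
preserved, and it yields `Z (2m+1) = G ∏ (1 - r^(2i+1)) / (1 - r^(2i+1) X²)`, the product over `1 ≤
i ≤ m`. The pole `X = 1/r` of `G` gives the main term `r^k (1 - r^n)`; the next poles, `X² = r⁻³`,
give the error `r^(3k/2)`. Uniformity in `n` comes from the geometric decay of `r^(2i+1)`
(`abs_detError_odd_le`). -/

instance padicIntHaar.instIsAddHaarMeasure (p : ℕ) [Fact p.Prime] :
    (padicIntHaar p).IsAddHaarMeasure := by
  unfold padicIntHaar; infer_instance

/-- A continuous surjective homomorphism of compact groups pushes the normalised Haar measure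
forward to the normalised Haar measure. -/
theorem measurePreserving_of_isAddHaarMeasure {G H : Type*}
    [AddGroup G] [TopologicalSpace G] [IsTopologicalAddGroup G] [MeasurableSpace G] [BorelSpace G]
    [AddGroup H] [TopologicalSpace H] [IsTopologicalAddGroup H] [MeasurableSpace H] [BorelSpace H]
    [LocallyCompactSpace H]
    (μ : Measure G) [μ.IsAddHaarMeasure] [IsProbabilityMeasure μ]
    (ν : Measure H) [ν.IsAddHaarMeasure] [IsProbabilityMeasure ν]
    (f : G →+ H) (hf : Continuous f) (hs : Function.Surjective f) :
    MeasurePreserving f μ ν := by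
  refine ⟨hf.measurable, ?_⟩
  have := Measure.isAddHaarMeasure_map_of_isFiniteMeasure μ f hf hs
  have := Measure.isProbabilityMeasure_map (μ := μ) hf.measurable.aemeasurable
  exact Measure.isAddHaarMeasure_eq_of_isProbabilityMeasure _ _

/-! ### Haar measure of balls in the `p`-adic integers. -/

section Balls

variable {p : ℕ} [hp : Fact p.Prime]

theorem padicInt_norm_eq_zpow {x : ℤ_[p]} (hx : x ≠ 0) : ‖x‖ = ((p : ℝ)⁻¹) ^ x.valuation := by
  rw [PadicInt.norm_eq_zpow_neg_valuation hx, zpow_neg, zpow_natCast, inv_pow]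

theorem inv_prime_pos : (0 : ℝ) < (p : ℝ)⁻¹ := by
  have := hp.out.pos
  positivity

theorem inv_prime_lt_one : ((p : ℝ)⁻¹) < 1 :=
  inv_lt_one_of_one_lt₀ (by exact_mod_cast hp.out.one_lt)

theorem padicInt_norm_p_pow (n : ℕ) : ‖(p : ℤ_[p]) ^ n‖ = ((p : ℝ)⁻¹) ^ n := by
  rw [norm_pow, PadicInt.norm_p]

theorem padicInt_norm_le_pow_iff (x : ℤ_[p]) (n : ℕ) :
    ‖x‖ ≤ ((p : ℝ)⁻¹) ^ n ↔ ∃ y, x = (p : ℤ_[p]) ^ n * y := by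
  have := PadicInt.norm_le_pow_iff_mem_span_pow x n
  rw [zpow_neg, zpow_natCast, ← inv_pow] at this
  rw [this, Ideal.mem_span_singleton]
  rfl

theorem padicInt_norm_lt_pow_iff (x : ℤ_[p]) (n : ℕ) :
    ‖x‖ < ((p : ℝ)⁻¹) ^ n ↔ ‖x‖ ≤ ((p : ℝ)⁻¹) ^ (n + 1) := by
  have := PadicInt.norm_lt_pow_iff_norm_le_pow_sub_one x (-n)
  rw [show (-(n : ℤ) - 1) = -((n + 1 : ℕ) : ℤ) by push_cast; ring] at this
  simpa only [zpow_neg, zpow_natCast, ← inv_pow] using this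

theorem padicIntHaar_real_closedBall_eq (b : ℤ_[p]) (n : ℕ) :
    (padicIntHaar p).real {x | ‖x - b‖ ≤ ((p : ℝ)⁻¹) ^ n} =
      (padicIntHaar p).real {x | ‖x‖ ≤ ((p : ℝ)⁻¹) ^ n} := by
  have := measure_preimage_add_right (padicIntHaar p) (-b) {x | ‖x‖ ≤ ((p : ℝ)⁻¹) ^ n}
  rw [measureReal_def, measureReal_def, ← this]
  simp [sub_eq_add_neg]

/-- The `p ^ n` fibres of reduction modulo `p ^ n` are translates of this ball, so they share the
total mass `1` equally. -/
theorem padicIntHaar_real_closedBall_zero (n : ℕ) :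
    (padicIntHaar p).real {x | ‖x‖ ≤ ((p : ℝ)⁻¹) ^ n} = ((p : ℝ)⁻¹) ^ n := by
  have hfib (z : ZMod (p ^ n)) : PadicInt.toZModPow n ⁻¹' {z} =
      {x : ℤ_[p] | ‖x - (z.val : ℤ_[p])‖ ≤ ((p : ℝ)⁻¹) ^ n} := by
    ext x
    have h := PadicInt.norm_le_pow_iff_mem_span_pow (x - (z.val : ℤ_[p])) n
    rw [zpow_neg, zpow_natCast, ← inv_pow] at h
    rw [Set.mem_ofPred_eq, h, ← PadicInt.ker_toZModPow, RingHom.mem_ker, map_sub, map_natCast,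
      ZMod.natCast_zmod_val, sub_eq_zero]
    rfl
  have hclosed (b : ℤ_[p]) : MeasurableSet {x : ℤ_[p] | ‖x - b‖ ≤ ((p : ℝ)⁻¹) ^ n} :=
    (isClosed_le (by fun_prop) continuous_const).measurableSet
  have hsum := sum_measureReal_preimage_singleton (μ := padicIntHaar p)
    (f := (PadicInt.toZModPow n : ℤ_[p] → ZMod (p ^ n))) Finset.univ
    (fun z _ => by rw [hfib]; exact hclosed _)
  simp only [hfib, padicIntHaar_real_closedBall_eq, Finset.sum_const, Finset.card_univ,
    ZMod.card, Finset.coe_univ, Set.preimage_univ, probReal_univ, nsmul_eq_mul] at hsum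
  push_cast at hsum
  simp only [inv_pow] at hsum ⊢
  exact eq_inv_of_mul_eq_one_right hsum

theorem padicIntHaar_real_closedBall (b : ℤ_[p]) (n : ℕ) :
    (padicIntHaar p).real {x | ‖x - b‖ ≤ ((p : ℝ)⁻¹) ^ n} = ((p : ℝ)⁻¹) ^ n := by
  rw [padicIntHaar_real_closedBall_eq, padicIntHaar_real_closedBall_zero]

end Balls

/-! ### Bordered determinants and the orbit of a vector under invertible matrices. -/

section SymmetricHaarMatrices

open Matrix

/-- Expansion of the determinant of a symmetrically bordered matrix along its border. -/
theorem Matrix.det_succ_eq_mul_det_sub_adjugate {R : Type*} [CommRing R] {n : ℕ}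
    (A : Matrix (Fin (n + 1)) (Fin (n + 1)) R) (c : Fin n → R) (Y : Matrix (Fin n) (Fin n) R)
    (hr : ∀ i, A 0 i.succ = c i) (hc : ∀ i, A i.succ 0 = c i)
    (hY : ∀ i j, A i.succ j.succ = Y i j) :
    A.det = A 0 0 * Y.det - c ⬝ᵥ (Y.adjugate *ᵥ c) := by
  have hsub : A.submatrix Fin.succ Fin.succ = Y := by
    ext i j; exact hY i j
  rw [det_succ_row_zero, Fin.sum_univ_succ, sub_eq_add_neg, ← cramer_eq_adjugate_mulVec,
    dotProduct, ← Finset.sum_neg_distrib]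
  congr 1
  · simp [Fin.succAbove_zero, hsub]
  · refine Finset.sum_congr rfl fun i _ => ?_
    -- Cycling the border column into the vacant place `i` turns the minor into a Cramer
    -- determinant; the sign of the cycle cancels the cofactor sign up to one factor `-1`.
    have hperm : (A.submatrix Fin.succ i.succ.succAbove).submatrix id i.cycleRange =
        Y.updateCol i c := by
      ext k j
      simp only [submatrix_apply, id, Fin.succAbove_cycleRange, updateCol_apply]
      split_ifs with h
      · subst h
        simp [hc]
      · rw [Equiv.swap_apply_of_ne_of_ne (Fin.succ_ne_zero _)
          (fun h' => h (Fin.succ_injective _ h')), hY]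
    have hdet := det_permute' i.cycleRange (A.submatrix Fin.succ i.succ.succAbove)
    rw [hperm, Fin.sign_cycleRange] at hdet
    rw [cramer_apply, hdet, hr]
    push_cast
    have h1 : ((-1 : R) ^ (i : ℕ)) * (-1) ^ (i : ℕ) = 1 := by
      rw [← mul_pow]; simp
    rw [Fin.val_succ, pow_succ]
    ring

/-- Every nonzero vector over `ℤ_[p]` is a power of `p` times the first column of an invertible
matrix; the power is read off from the sup norm. -/
theorem padicInt_exists_eq_pow_smul_col {p : ℕ} [Fact p.Prime] {m : ℕ}
    (c : Fin (m + 1) → ℤ_[p]) (hc : c ≠ 0) :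
    ∃ (j : ℕ) (g : Matrix (Fin (m + 1)) (Fin (m + 1)) ℤ_[p]), IsUnit g.det ∧
      ‖c‖ = ((p : ℝ)⁻¹) ^ j ∧ c = (p : ℤ_[p]) ^ j • (g *ᵥ Pi.single 0 1) := by
  obtain ⟨i, -, hi⟩ := Finset.exists_max_image Finset.univ (fun i => ‖c i‖)
    Finset.univ_nonempty
  have hnorm : ‖c‖ = ‖c i‖ :=
    le_antisymm ((pi_norm_le_iff_of_nonneg (norm_nonneg _)).2 fun k => hi k (Finset.mem_univ k))
      (norm_le_pi_norm c i)
  have hci : c i ≠ 0 := by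
    rw [← norm_ne_zero_iff, ← hnorm]
    exact norm_ne_zero_iff.2 hc
  have hval := padicInt_norm_eq_zpow hci
  set j := (c i).valuation
  have hdvd (k) : ∃ y, c k = (p : ℤ_[p]) ^ j * y := by
    rw [← padicInt_norm_le_pow_iff, ← hval]
    exact hi k (Finset.mem_univ k)
  choose d hd using hdvd
  have hdi : IsUnit (d i) := by
    rw [PadicInt.isUnit_iff]
    have : ‖c i‖ = ((p : ℝ)⁻¹) ^ j * ‖d i‖ := by rw [hd i, norm_mul, padicInt_norm_p_pow]
    rw [hval] at this
    have hpos : (0 : ℝ) < ((p : ℝ)⁻¹) ^ j := pow_pos inv_prime_pos j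
    exact (mul_eq_left₀ hpos.ne').1 this.symm
  -- The row swap puts the unit entry `d i` on the diagonal: the first column is `d` and the
  -- determinant is `± d i`.
  refine ⟨j, ((1 : Matrix _ _ ℤ_[p]).updateCol 0 (d ∘ Equiv.swap 0 i)).submatrix
    (Equiv.swap 0 i) id, ?_, hnorm.trans hval, ?_⟩
  · rw [det_permute, ← cramer_apply, cramer_one]
    refine IsUnit.mul ?_ ?_
    · exact (Units.map (Int.castRingHom ℤ_[p] : ℤ →* ℤ_[p]) (Equiv.Perm.sign (Equiv.swap 0 i))).isUnit
    · simpa using hdi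
  · ext k
    simp [hd k]

/-! ### Coordinates on symmetric matrices. -/

section SymmetricMatrices

/-- The coordinates of a symmetric matrix: its entries on and above the diagonal. -/
abbrev UpperTriangle (R : Type*) (n : ℕ) : Type _ := {e : Fin n × Fin n // e.1 ≤ e.2} → R

/-- The symmetric matrix with prescribed entries on and above the diagonal. -/
def symMatrix {R : Type*} {n : ℕ} (x : UpperTriangle R n) : Matrix (Fin n) (Fin n) R :=
  Matrix.of fun i j => if h : i ≤ j then x ⟨(i, j), h⟩ else x ⟨(j, i), (not_le.1 h).le⟩

/-- The entries of a matrix on and above the diagonal. -/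
def upperTriangle {R : Type*} {n : ℕ} (A : Matrix (Fin n) (Fin n) R) : UpperTriangle R n :=
  fun e => A e.1.1 e.1.2

variable {R : Type*} {n : ℕ}

theorem symMatrix_isSymm (x : UpperTriangle R n) : (symMatrix x).IsSymm := by
  ext i j
  simp only [symMatrix, transpose_apply, of_apply]
  rcases lt_trichotomy i j with h | h | h
  · rw [dif_neg h.not_ge, dif_pos h.le]
  · subst h; rfl
  · rw [dif_pos h.le, dif_neg h.not_ge]

theorem upperTriangle_symMatrix (x : UpperTriangle R n) : upperTriangle (symMatrix x) = x := by
  ext ⟨e, he⟩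
  simp [upperTriangle, symMatrix, he]

theorem symMatrix_upperTriangle {A : Matrix (Fin n) (Fin n) R} (hA : A.IsSymm) :
    symMatrix (upperTriangle A) = A := by
  ext i j
  by_cases h : i ≤ j
  · simp [upperTriangle, symMatrix, h]
  · simp [upperTriangle, symMatrix, hA.apply]

theorem symMatrix_add [Add R] (x y : UpperTriangle R n) :
    symMatrix (x + y) = symMatrix x + symMatrix y := by
  ext i j
  by_cases h : i ≤ j <;> simp [symMatrix, h]

theorem upperTriangle_add [Add R] (A B : Matrix (Fin n) (Fin n) R) :
    upperTriangle (A + B) = upperTriangle A + upperTriangle B := rfl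

theorem continuous_symMatrix [TopologicalSpace R] :
    Continuous (symMatrix : UpperTriangle R n → Matrix (Fin n) (Fin n) R) := by
  refine continuous_matrix fun i j => ?_
  by_cases h : i ≤ j <;> simp only [symMatrix, of_apply, h, dite_true, dite_false] <;> fun_prop

theorem continuous_upperTriangle [TopologicalSpace R] :
    Continuous (upperTriangle : Matrix (Fin n) (Fin n) R → UpperTriangle R n) := by
  unfold upperTriangle
  exact continuous_pi fun e => continuous_id.matrix_elem _ _

end SymmetricMatrices

/-! ### Haar measure under congruence and under splitting off a border. -/

section HaarMeasures

variable {p : ℕ} [hp : Fact p.Prime] {n : ℕ}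

/-- The law of a Haar symmetric matrix, in coordinates. -/
noncomputable abbrev upperHaar (p : ℕ) [Fact p.Prime] (n : ℕ) :
    Measure (UpperTriangle ℤ_[p] n) :=
  Measure.pi fun _ => padicIntHaar p

/-- The law of a Haar vector. -/
noncomputable abbrev vectorHaar (p : ℕ) [Fact p.Prime] (n : ℕ) : Measure (Fin n → ℤ_[p]) :=
  Measure.pi fun _ => padicIntHaar p

/-- The congruence action of a matrix on symmetric matrices. -/
def congruenceHom {R : Type*} [CommRing R] {n : ℕ} (g : Matrix (Fin n) (Fin n) R) :
    UpperTriangle R n →+ UpperTriangle R n :=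
  AddMonoidHom.mk' (fun x => upperTriangle (g * symMatrix x * gᵀ)) fun x y => by
    rw [symMatrix_add, Matrix.mul_add, Matrix.add_mul, upperTriangle_add]

theorem symMatrix_congruenceHom {R : Type*} [CommRing R] {n : ℕ} (g : Matrix (Fin n) (Fin n) R)
    (x : UpperTriangle R n) : symMatrix (congruenceHom g x) = g * symMatrix x * gᵀ := by
  refine symMatrix_upperTriangle (A := g * symMatrix x * gᵀ) ?_
  rw [IsSymm, transpose_mul, transpose_mul, transpose_transpose, (symMatrix_isSymm x).eq,
    Matrix.mul_assoc]

theorem measurePreserving_congruenceHom (g : Matrix (Fin n) (Fin n) ℤ_[p]) (hg : IsUnit g.det) :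
    MeasurePreserving (congruenceHom g) (upperHaar p n) (upperHaar p n) := by
  refine measurePreserving_of_isAddHaarMeasure _ _ _ ?_ fun y => ⟨congruenceHom g⁻¹ y, ?_⟩
  · exact continuous_upperTriangle.comp
      ((continuous_const.matrix_mul continuous_symMatrix).matrix_mul continuous_const)
  · rw [← upperTriangle_symMatrix (congruenceHom g _), symMatrix_congruenceHom,
      symMatrix_congruenceHom, transpose_nonsing_inv, ← Matrix.mul_assoc, ← Matrix.mul_assoc,
      mul_nonsing_inv _ hg, Matrix.one_mul, Matrix.mul_assoc,
      nonsing_inv_mul _ (by rwa [det_transpose]), Matrix.mul_one, upperTriangle_symMatrix]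

/-- A symmetric matrix as its corner, its border and the complementary principal minor. -/
def borderHom (R : Type*) [AddGroup R] (n : ℕ) :
    UpperTriangle R (n + 1) →+ R × ((Fin n → R) × UpperTriangle R n) :=
  AddMonoidHom.mk' (fun x => (symMatrix x 0 0, fun i => symMatrix x 0 i.succ,
    upperTriangle ((symMatrix x).submatrix Fin.succ Fin.succ))) fun x y => by
    rw [symMatrix_add]; rfl

theorem symMatrix_borderHom {R : Type*} [AddGroup R] (x : UpperTriangle R (n + 1)) :
    symMatrix (borderHom R n x).2.2 = (symMatrix x).submatrix Fin.succ Fin.succ :=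
  symMatrix_upperTriangle ((symMatrix_isSymm x).submatrix _)

theorem borderHom_surjective (R : Type*) [AddGroup R] (n : ℕ) :
    Function.Surjective (borderHom R n) := by
  rintro ⟨a, c, y⟩
  let A : Matrix (Fin (n + 1)) (Fin (n + 1)) R :=
    Matrix.of (Fin.cons (Fin.cons a c) fun i => Fin.cons (c i) (symMatrix y i))
  have hA : A.IsSymm := by
    ext i j
    refine Fin.cases ?_ (fun i => ?_) i <;> refine Fin.cases ?_ (fun j => ?_) j <;> simp [A]
    exact (symMatrix_isSymm y).apply _ _
  refine ⟨upperTriangle A, ?_⟩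
  have h : borderHom R n (upperTriangle A) =
    (A 0 0, fun i => A 0 i.succ, upperTriangle (A.submatrix Fin.succ Fin.succ)) := by
    simp [borderHom, symMatrix_upperTriangle hA]
  rw [h]
  refine Prod.ext (by simp [A]) (Prod.ext (by ext; simp [A]) ?_)
  have : A.submatrix Fin.succ Fin.succ = symMatrix y := by ext; simp [A]
  rw [this, upperTriangle_symMatrix]

theorem measurePreserving_borderHom :
    MeasurePreserving (borderHom ℤ_[p] n) (upperHaar p (n + 1))
      ((padicIntHaar p).prod ((vectorHaar p n).prod (upperHaar p n))) := by
  have := Measure.prod.instIsAddHaarMeasure (vectorHaar p n) (upperHaar p n)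
  have := Measure.prod.instIsAddHaarMeasure (padicIntHaar p)
    ((vectorHaar p n).prod (upperHaar p n))
  refine measurePreserving_of_isAddHaarMeasure _ _ _ ?_ (borderHom_surjective _ _)
  have h := continuous_symMatrix (R := ℤ_[p]) (n := n + 1)
  exact (h.matrix_elem 0 0).prodMk ((continuous_pi fun i => h.matrix_elem _ _).prodMk
    (continuous_upperTriangle.comp (h.matrix_submatrix _ _)))

/-- The determinant of a symmetric matrix in coordinates. -/
noncomputable def symDet {R : Type*} [CommRing R] {n : ℕ} (x : UpperTriangle R n) : R :=
  (symMatrix x).det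

/-- The quadratic form of the adjugate matrix. -/
noncomputable def adjugateForm {R : Type*} [CommRing R] {n : ℕ}
    (w : (Fin n → R) × UpperTriangle R n) : R :=
  w.1 ⬝ᵥ ((symMatrix w.2).adjugate *ᵥ w.1)

theorem symDet_succ {R : Type*} [CommRing R] (x : UpperTriangle R (n + 1)) :
    symDet x = (borderHom R n x).1 * symDet (borderHom R n x).2.2 -
      adjugateForm (borderHom R n x).2 := by
  rw [symDet, symDet, adjugateForm, symMatrix_borderHom]
  exact det_succ_eq_mul_det_sub_adjugate _ _ _ (fun _ => rfl)
    (fun i => (symMatrix_isSymm x).apply _ _) fun _ _ => rfl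

theorem continuous_symDet : Continuous (symDet : UpperTriangle ℤ_[p] n → ℤ_[p]) :=
  continuous_symMatrix.matrix_det

theorem continuous_adjugateForm :
    Continuous (adjugateForm : (Fin n → ℤ_[p]) × UpperTriangle ℤ_[p] n → ℤ_[p]) :=
  continuous_fst.dotProduct
    ((continuous_symMatrix.comp continuous_snd).matrix_adjugate.matrix_mulVec continuous_fst)

theorem continuous_borderHom_minor :
    Continuous fun x : UpperTriangle ℤ_[p] (n + 1) => (borderHom ℤ_[p] n x).2.2 :=
  continuous_upperTriangle.comp (continuous_symMatrix.matrix_submatrix _ _)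

end HaarMeasures

/-! ### The determinant and the adjugate form under congruence. -/

section Conjugation

theorem symDet_congruenceHom {R : Type*} [CommRing R] {n : ℕ} (g : Matrix (Fin n) (Fin n) R)
    (x : UpperTriangle R n) : symDet (congruenceHom g x) = g.det ^ 2 * symDet x := by
  rw [symDet, symDet, symMatrix_congruenceHom, det_mul, det_mul, det_transpose]
  ring

/-- Since `adj(g x gᵀ) = adj(g)ᵀ adj(x) adj(g)` and `adj(g) g = det g`, only the entry `adj(x) 0 0`
is left, and this is the corner minor. -/
theorem adjugateForm_congruenceHom {R : Type*} [CommRing R] {m : ℕ} (a : R)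
    (g : Matrix (Fin (m + 1)) (Fin (m + 1)) R) (x : UpperTriangle R (m + 1)) :
    adjugateForm (a • (g *ᵥ Pi.single 0 1), congruenceHom g x) =
      a ^ 2 * g.det ^ 2 * symDet (borderHom R m x).2.2 := by
  have h1 : g.adjugate *ᵥ (g *ᵥ Pi.single 0 1) = g.det • Pi.single 0 1 := by
    rw [mulVec_mulVec, adjugate_mul, smul_mulVec, one_mulVec]
  have h2 : (symMatrix x).adjugate 0 0 = symDet (borderHom R m x).2.2 := by
    rw [adjugate_fin_succ_eq_det_submatrix, symDet, symMatrix_borderHom]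
    simp [Fin.succAbove_zero]
  rw [adjugateForm, symMatrix_congruenceHom, adjugate_mul_distrib, adjugate_mul_distrib,
    ← mulVec_mulVec, ← mulVec_mulVec, mulVec_smul, mulVec_smul, mulVec_smul, h1,
    dotProduct_smul, smul_dotProduct, dotProduct_mulVec, ← adjugate_transpose, vecMul_transpose,
    h1, smul_dotProduct, mulVec_smul, dotProduct_smul]
  simp [h2]
  ring

end Conjugation

/-! ### Conditioning on the corner and on the size of the border. -/

section Recursion

variable {p : ℕ} [hp : Fact p.Prime]

/-- The law of the border and the complementary minor of a Haar symmetric matrix. -/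
noncomputable abbrev borderHaar (p : ℕ) [Fact p.Prime] (m : ℕ) :
    Measure ((Fin m → ℤ_[p]) × UpperTriangle ℤ_[p] m) :=
  (vectorHaar p m).prod (upperHaar p m)

/-- If `d` divides `s = t * d`, the condition reads `‖a - t‖ ≤ r ^ u`, a ball; otherwise `‖a * d‖ <
‖s‖` and `s` dominates. -/
theorem haar_norm_mul_sub_le (d s : ℤ_[p]) (y u : ℕ) (hd : ‖d‖ = ((p : ℝ)⁻¹) ^ y) :
    padicIntHaar p {a | ‖a * d - s‖ ≤ ((p : ℝ)⁻¹) ^ (y + u)} =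
      if ‖s‖ ≤ ((p : ℝ)⁻¹) ^ y then ENNReal.ofReal (((p : ℝ)⁻¹) ^ u) else 0 := by
  have hpos : (0 : ℝ) < ((p : ℝ)⁻¹) ^ y := pow_pos inv_prime_pos y
  split_ifs with hs
  · obtain ⟨t, rfl⟩ : ∃ t, s = t * d := by
      obtain ⟨e, he⟩ := (padicInt_norm_le_pow_iff d y).1 hd.le
      obtain ⟨t, ht⟩ := (padicInt_norm_le_pow_iff s y).1 hs
      have hue : IsUnit e := by
        rw [PadicInt.isUnit_iff]
        rw [he, norm_mul, padicInt_norm_p_pow] at hd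
        exact (mul_eq_left₀ hpos.ne').1 hd
      obtain ⟨v, rfl⟩ := hue
      refine ⟨t * ↑v⁻¹, ?_⟩
      rw [ht, he, mul_assoc, mul_left_comm _ _ (v : ℤ_[p]), Units.inv_mul]
      ring
    rw [← padicIntHaar_real_closedBall t u, measureReal_def,
      ENNReal.ofReal_toReal (measure_ne_top _ _)]
    congr 1
    ext a
    rw [Set.mem_ofPred_eq, Set.mem_ofPred_eq, ← sub_mul, norm_mul, hd, pow_add, mul_comm]
    exact mul_le_mul_iff_right₀ hpos
  · rw [not_le] at hs
    convert measure_empty (μ := padicIntHaar p)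
    rw [Set.eq_empty_iff_forall_notMem]
    intro a ha
    have h1 : ‖a * d‖ < ‖s‖ := by
      rw [norm_mul, hd]
      exact (mul_le_of_le_one_left hpos.le (PadicInt.norm_le_one a)).trans_lt hs
    have h2 : ‖a * d - s‖ = ‖s‖ := by
      rw [sub_eq_add_neg, PadicInt.norm_add_eq_max_of_ne (by rw [norm_neg]; exact h1.ne),
        norm_neg, max_eq_right h1.le]
    rw [Set.mem_ofPred_eq, h2] at ha
    refine (ha.trans_lt (lt_of_le_of_lt ?_ hs)).false
    exact pow_le_pow_of_le_one inv_prime_pos.le inv_prime_lt_one.le (Nat.le_add_right _ _)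

/-- On the event that the corner minor divides the adjugate form of the border, the quotient of the
determinant by the corner minor is Haar distributed. -/
theorem upperHaar_minor_eq_det_le (m y u : ℕ) :
    (upperHaar p (m + 1)).real {x | ‖symDet (borderHom ℤ_[p] m x).2.2‖ = ((p : ℝ)⁻¹) ^ y ∧
        ‖symDet x‖ ≤ ((p : ℝ)⁻¹) ^ (y + u)} =
      ((p : ℝ)⁻¹) ^ u * (borderHaar p m).real {w | ‖symDet w.2‖ = ((p : ℝ)⁻¹) ^ y ∧
        ‖adjugateForm w‖ ≤ ((p : ℝ)⁻¹) ^ y} := by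
  have hD : Continuous fun w : (Fin m → ℤ_[p]) × UpperTriangle ℤ_[p] m => symDet w.2 :=
    continuous_symDet.comp continuous_snd
  have hA := continuous_adjugateForm (p := p) (n := m)
  set S : Set (ℤ_[p] × ((Fin m → ℤ_[p]) × UpperTriangle ℤ_[p] m)) :=
    {q | ‖symDet q.2.2‖ = ((p : ℝ)⁻¹) ^ y ∧
      ‖q.1 * symDet q.2.2 - adjugateForm q.2‖ ≤ ((p : ℝ)⁻¹) ^ (y + u)}
  set W : Set ((Fin m → ℤ_[p]) × UpperTriangle ℤ_[p] m) :=
    {w | ‖symDet w.2‖ = ((p : ℝ)⁻¹) ^ y ∧ ‖adjugateForm w‖ ≤ ((p : ℝ)⁻¹) ^ y}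
  have hS : MeasurableSet S := by
    have h1 : Continuous fun q : ℤ_[p] × ((Fin m → ℤ_[p]) × UpperTriangle ℤ_[p] m) =>
      symDet q.2.2 := hD.comp continuous_snd
    exact ((isClosed_eq h1.norm continuous_const).inter (isClosed_le
      ((continuous_fst.mul h1).sub (hA.comp continuous_snd)).norm continuous_const)).measurableSet
  have hW : MeasurableSet W :=
    ((isClosed_eq hD.norm continuous_const).inter
      (isClosed_le hA.norm continuous_const)).measurableSet
  have hpre : {x : UpperTriangle ℤ_[p] (m + 1) |
      ‖symDet (borderHom ℤ_[p] m x).2.2‖ = ((p : ℝ)⁻¹) ^ y ∧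
        ‖symDet x‖ ≤ ((p : ℝ)⁻¹) ^ (y + u)} = borderHom ℤ_[p] m ⁻¹' S := by
    ext x
    simp only [S, Set.mem_ofPred_eq, Set.mem_preimage, symDet_succ x]
  have hfib (w) : padicIntHaar p ((fun a => (a, w)) ⁻¹' S) =
      W.indicator (fun _ => ENNReal.ofReal (((p : ℝ)⁻¹) ^ u)) w := by
    by_cases hd : ‖symDet w.2‖ = ((p : ℝ)⁻¹) ^ y
    · have := haar_norm_mul_sub_le _ (adjugateForm w) y u hd
      simpa [S, W, Set.indicator, hd, Set.preimage] using this
    · simp [S, W, Set.indicator, hd, -inv_pow]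
  rw [hpre, measureReal_def, measurePreserving_borderHom.measure_preimage hS.nullMeasurableSet,
    Measure.prod_apply_symm hS]
  simp_rw [hfib]
  rw [lintegral_indicator_const hW, ENNReal.toReal_mul,
    ENNReal.toReal_ofReal (pow_nonneg inv_prime_pos.le u)]
  rfl

/-- The product of the corner and the minor is smaller than `r ^ x`, so it cannot affect whether the
determinant has norm `r ^ x`, and the corner integrates out. -/
theorem upperHaar_minor_lt_det_eq (m x : ℕ) :
    (upperHaar p (m + 1)).real {z | ‖symDet (borderHom ℤ_[p] m z).2.2‖ < ((p : ℝ)⁻¹) ^ x ∧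
        ‖symDet z‖ = ((p : ℝ)⁻¹) ^ x} =
      (borderHaar p m).real {w | ‖symDet w.2‖ < ((p : ℝ)⁻¹) ^ x ∧
        ‖adjugateForm w‖ = ((p : ℝ)⁻¹) ^ x} := by
  have hD : Continuous fun w : (Fin m → ℤ_[p]) × UpperTriangle ℤ_[p] m => symDet w.2 :=
    continuous_symDet.comp continuous_snd
  set W : Set ((Fin m → ℤ_[p]) × UpperTriangle ℤ_[p] m) :=
    {w | ‖symDet w.2‖ < ((p : ℝ)⁻¹) ^ x ∧ ‖adjugateForm w‖ = ((p : ℝ)⁻¹) ^ x}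
  have hW : MeasurableSet W :=
    (isOpen_lt hD.norm continuous_const).measurableSet.inter
      (isClosed_eq continuous_adjugateForm.norm continuous_const).measurableSet
  have hpre : {z : UpperTriangle ℤ_[p] (m + 1) |
      ‖symDet (borderHom ℤ_[p] m z).2.2‖ < ((p : ℝ)⁻¹) ^ x ∧
        ‖symDet z‖ = ((p : ℝ)⁻¹) ^ x} = (Prod.snd ∘ borderHom ℤ_[p] m) ⁻¹' W := by
    ext z
    simp only [W, Set.mem_ofPred_eq, Set.mem_preimage, Function.comp, symDet_succ z]
    refine and_congr_right fun h => ?_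
    set b := borderHom ℤ_[p] m z
    have h1 : ‖b.1 * symDet b.2.2‖ < ((p : ℝ)⁻¹) ^ x := by
      rw [norm_mul]
      exact (mul_le_of_le_one_left (norm_nonneg _) (PadicInt.norm_le_one _)).trans_lt h
    constructor <;> intro h2
    · have h3 := PadicInt.norm_add_eq_max_of_ne (q := b.1 * symDet b.2.2)
        (r := -(b.1 * symDet b.2.2 - adjugateForm b.2)) (by rw [norm_neg, h2]; exact h1.ne)
      rw [norm_neg, h2, max_eq_right h1.le] at h3
      rw [← h3]
      congr 1
      ring
    · rw [sub_eq_add_neg, PadicInt.norm_add_eq_max_of_ne (by rw [norm_neg, h2]; exact h1.ne),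
        norm_neg, h2, max_eq_right h1.le]
  rw [hpre, measureReal_def,
    (measurePreserving_snd.comp measurePreserving_borderHom).measure_preimage
      hW.nullMeasurableSet, measureReal_def]

/-- Conditionally on the size of the border, the adjugate form is distributed as the corresponding
multiple of the corner minor. -/
theorem borderHaar_norm_sq_eq (l i : ℕ) (P : ℝ → ℝ → Prop)
    (hP : MeasurableSet {q : ℝ × ℝ | P q.1 q.2}) :
    (borderHaar p (l + 1)).real {w | ‖w.1‖ ^ 2 = ((p : ℝ)⁻¹) ^ i ∧
        P ‖adjugateForm w‖ ‖symDet w.2‖} =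
      (vectorHaar p (l + 1)).real {c | ‖c‖ ^ 2 = ((p : ℝ)⁻¹) ^ i} *
        (upperHaar p (l + 1)).real
          {x | P (((p : ℝ)⁻¹) ^ i * ‖symDet (borderHom ℤ_[p] l x).2.2‖) ‖symDet x‖} := by
  set V : Set (Fin (l + 1) → ℤ_[p]) := {c | ‖c‖ ^ 2 = ((p : ℝ)⁻¹) ^ i}
  have hV : MeasurableSet V :=
    (isClosed_eq (continuous_norm.pow 2) continuous_const).measurableSet
  have hD : Continuous fun w : (Fin (l + 1) → ℤ_[p]) × UpperTriangle ℤ_[p] (l + 1) =>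
    symDet w.2 := continuous_symDet.comp continuous_snd
  set S : Set ((Fin (l + 1) → ℤ_[p]) × UpperTriangle ℤ_[p] (l + 1)) :=
    {w | ‖w.1‖ ^ 2 = ((p : ℝ)⁻¹) ^ i ∧ P ‖adjugateForm w‖ ‖symDet w.2‖}
  have hS : MeasurableSet S :=
    (measurable_fst hV).inter
      ((continuous_adjugateForm.norm.measurable.prodMk hD.norm.measurable) hP)
  set X : Set (UpperTriangle ℤ_[p] (l + 1)) :=
    {x | P (((p : ℝ)⁻¹) ^ i * ‖symDet (borderHom ℤ_[p] l x).2.2‖) ‖symDet x‖}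
  have hfib (c) : upperHaar p (l + 1) (Prod.mk c ⁻¹' S) =
      V.indicator (fun _ => upperHaar p (l + 1) X) c := by
    by_cases hc : ‖c‖ ^ 2 = ((p : ℝ)⁻¹) ^ i
    · have hc0 : c ≠ 0 := by
        rintro rfl
        have := pow_pos (inv_prime_pos (p := p)) i
        rw [← hc] at this
        simp at this
      obtain ⟨j, g, hg, hcj, hcg⟩ := padicInt_exists_eq_pow_smul_col c hc0
      have hmeas : MeasurableSet (Prod.mk c ⁻¹' S) := measurable_prodMk_left hS
      -- For fixed `c`, the minor is replaced by its congruence by the matrix `g` that carries `e₀`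
      -- to `c` up to a power of `p`.
      rw [← (measurePreserving_congruenceHom g hg).measure_preimage hmeas.nullMeasurableSet,
        Set.indicator_of_mem (show c ∈ V from hc)]
      congr 1
      ext x
      have hg1 : ‖g.det‖ = 1 := PadicInt.isUnit_iff.1 hg
      have h1 : ‖adjugateForm (c, congruenceHom g x)‖ =
          ((p : ℝ)⁻¹) ^ i * ‖symDet (borderHom ℤ_[p] l x).2.2‖ := by
        rw [← hc, hcj]
        conv_lhs => rw [hcg]
        simp only [adjugateForm_congruenceHom, norm_mul, norm_pow, hg1, PadicInt.norm_p]
        ring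
      have h2 : ‖symDet (congruenceHom g x)‖ = ‖symDet x‖ := by
        rw [symDet_congruenceHom, norm_mul, norm_pow, hg1]
        ring
      simp only [S, X, Set.mem_preimage, Set.mem_ofPred_eq, h1, h2, hc, true_and]
    · simp [S, V, hc, -inv_pow]
  rw [measureReal_def, Measure.prod_apply hS]
  simp_rw [hfib]
  rw [lintegral_indicator_const hV, ENNReal.toReal_mul, mul_comm]
  rfl

theorem norm_adjugateForm_le (m : ℕ) (w : (Fin m → ℤ_[p]) × UpperTriangle ℤ_[p] m) :
    ‖adjugateForm w‖ ≤ ‖w.1‖ ^ 2 := by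
  cases m with
  | zero => simp [adjugateForm]
  | succ m =>
    obtain ⟨c, x⟩ := w
    by_cases hc : c = 0
    · simp [adjugateForm, hc]
    · obtain ⟨j, g, hg, hcj, hcg⟩ := padicInt_exists_eq_pow_smul_col c hc
      have : adjugateForm (c, x) = ((p : ℤ_[p]) ^ j) ^ 2 *
          adjugateForm (g *ᵥ Pi.single 0 1, x) := by
        simp only [adjugateForm]
        rw [hcg, mulVec_smul, dotProduct_smul, smul_dotProduct, smul_eq_mul, smul_eq_mul]
        ring
      rw [this, norm_mul, norm_pow, padicInt_norm_p_pow, ← hcj]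
      exact mul_le_of_le_one_right (by positivity) (PadicInt.norm_le_one _)

/-- The form is at most `‖c‖ ^ 2`, so `hPx` excludes `c = 0` and leaves only the finitely many
border sizes `i ≤ x`. -/
theorem borderHaar_eq_sum (l x : ℕ) (P : ℝ → ℝ → Prop)
    (hP : MeasurableSet {q : ℝ × ℝ | P q.1 q.2})
    (hPx : ∀ s d, P s d → ((p : ℝ)⁻¹) ^ x ≤ s) :
    (borderHaar p (l + 1)).real {w | P ‖adjugateForm w‖ ‖symDet w.2‖} =
      ∑ i ∈ Finset.range (x + 1),
        (vectorHaar p (l + 1)).real {c | ‖c‖ ^ 2 = ((p : ℝ)⁻¹) ^ i} *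
        (upperHaar p (l + 1)).real
          {x | P (((p : ℝ)⁻¹) ^ i * ‖symDet (borderHom ℤ_[p] l x).2.2‖) ‖symDet x‖} := by
  simp_rw [← borderHaar_norm_sq_eq l _ P hP]
  have hD : Continuous fun w : (Fin (l + 1) → ℤ_[p]) × UpperTriangle ℤ_[p] (l + 1) =>
    symDet w.2 := continuous_symDet.comp continuous_snd
  rw [← measureReal_biUnion_finset]
  · congr 1
    ext w
    simp only [Set.mem_iUnion, Set.mem_ofPred_eq, Finset.mem_range, exists_and_right, exists_prop]
    refine ⟨fun h => ⟨?_, h⟩, fun h => h.2⟩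
    have hle := (hPx _ _ h).trans (norm_adjugateForm_le _ w)
    have hw : w.1 ≠ 0 := by
      intro hw
      rw [hw] at hle
      have := pow_pos (inv_prime_pos (p := p)) x
      simp at hle this
      linarith
    obtain ⟨j, -, -, hj, -⟩ := padicInt_exists_eq_pow_smul_col w.1 hw
    refine ⟨j * 2, ?_, by rw [hj, pow_mul]⟩
    rw [hj, ← pow_mul] at hle
    have := (pow_le_pow_iff_right_of_lt_one₀ inv_prime_pos inv_prime_lt_one).1 hle
    omega
  · intro i _ j _ hij
    refine Set.disjoint_left.2 fun w hi hj => hij ?_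
    exact pow_right_injective₀ inv_prime_pos inv_prime_lt_one.ne (hi.1.symm.trans hj.1)
  · intro i _
    exact (isClosed_eq (continuous_fst.norm.pow 2) continuous_const).measurableSet.inter
      ((continuous_adjugateForm.norm.measurable.prodMk hD.norm.measurable) hP)

end Recursion

/-! ### Recursions for the distributions of the determinant and the minor. -/

section Distribution

variable (p : ℕ) [hp : Fact p.Prime]

/-- The distribution of the valuation of the determinant of a Haar symmetric matrix. -/
noncomputable def detProb (n k : ℕ) : ℝ :=
  (upperHaar p n).real {x | ‖symDet x‖ = ((p : ℝ)⁻¹) ^ k}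

/-- The distribution of the valuation of the corner minor, on the event that it divides the
determinant. -/
noncomputable def minorProb (m y : ℕ) : ℝ :=
  (upperHaar p (m + 1)).real {x | ‖symDet (borderHom ℤ_[p] m x).2.2‖ = ((p : ℝ)⁻¹) ^ y ∧
    ‖symDet x‖ ≤ ((p : ℝ)⁻¹) ^ y}

/-- The distribution of twice the valuation of a Haar vector. -/
noncomputable def normSqProb (m i : ℕ) : ℝ :=
  (vectorHaar p m).real {c | ‖c‖ ^ 2 = ((p : ℝ)⁻¹) ^ i}

variable {p}

theorem measurableSet_minor_det (m : ℕ) {s : Set (ℝ × ℝ)} (hs : MeasurableSet s) :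
    MeasurableSet {x : UpperTriangle ℤ_[p] (m + 1) |
      (‖symDet (borderHom ℤ_[p] m x).2.2‖, ‖symDet x‖) ∈ s} :=
  ((continuous_symDet.comp continuous_borderHom_minor).norm.prodMk
    continuous_symDet.norm).measurable hs

theorem minorProb_eq_borderHaar (m y : ℕ) :
    minorProb p m y = (borderHaar p m).real {w | ‖symDet w.2‖ = ((p : ℝ)⁻¹) ^ y ∧
        ‖adjugateForm w‖ ≤ ((p : ℝ)⁻¹) ^ y} := by
  simpa only [minorProb, pow_zero, one_mul, add_zero] using
    upperHaar_minor_eq_det_le (p := p) m y 0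

theorem upperHaar_minor_eq_det_le' (m y u : ℕ) :
    (upperHaar p (m + 1)).real {x | ‖symDet (borderHom ℤ_[p] m x).2.2‖ = ((p : ℝ)⁻¹) ^ y ∧
        ‖symDet x‖ ≤ ((p : ℝ)⁻¹) ^ (y + u)} = ((p : ℝ)⁻¹) ^ u * minorProb p m y := by
  rw [upperHaar_minor_eq_det_le, minorProb_eq_borderHaar]

theorem upperHaar_minor_eq_det_lt (m y u : ℕ) :
    (upperHaar p (m + 1)).real {x | ‖symDet (borderHom ℤ_[p] m x).2.2‖ = ((p : ℝ)⁻¹) ^ y ∧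
        ‖symDet x‖ < ((p : ℝ)⁻¹) ^ (y + u)} = ((p : ℝ)⁻¹) ^ (u + 1) * minorProb p m y := by
  simp_rw [padicInt_norm_lt_pow_iff, add_assoc]
  exact upperHaar_minor_eq_det_le' m y (u + 1)

theorem upperHaar_minor_eq_det_eq (m y u : ℕ) :
    (upperHaar p (m + 1)).real {x | ‖symDet (borderHom ℤ_[p] m x).2.2‖ = ((p : ℝ)⁻¹) ^ y ∧
        ‖symDet x‖ = ((p : ℝ)⁻¹) ^ (y + u)} =
      minorProb p m y * (((p : ℝ)⁻¹) ^ u * (1 - (p : ℝ)⁻¹)) := by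
  have hsplit : {x : UpperTriangle ℤ_[p] (m + 1) |
      ‖symDet (borderHom ℤ_[p] m x).2.2‖ = ((p : ℝ)⁻¹) ^ y ∧
        ‖symDet x‖ = ((p : ℝ)⁻¹) ^ (y + u)} =
      {x | ‖symDet (borderHom ℤ_[p] m x).2.2‖ = ((p : ℝ)⁻¹) ^ y ∧
        ‖symDet x‖ ≤ ((p : ℝ)⁻¹) ^ (y + u)} \
      {x | ‖symDet (borderHom ℤ_[p] m x).2.2‖ = ((p : ℝ)⁻¹) ^ y ∧
        ‖symDet x‖ < ((p : ℝ)⁻¹) ^ (y + u)} := by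
    ext x
    simp only [Set.mem_sdiff, Set.mem_ofPred_eq, not_and, not_lt]
    exact ⟨fun h => ⟨⟨h.1, h.2.le⟩, fun _ => h.2.ge⟩,
      fun h => ⟨h.1.1, le_antisymm h.1.2 (h.2 h.1.1)⟩⟩
  rw [hsplit, measureReal_sdiff, upperHaar_minor_eq_det_le', upperHaar_minor_eq_det_lt]
  · ring
  · exact fun x hx => ⟨hx.1, hx.2.le⟩
  · refine measurableSet_minor_det m (s := {q | q.1 = ((p : ℝ)⁻¹) ^ y ∧
      q.2 < ((p : ℝ)⁻¹) ^ (y + u)}) ?_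
    measurability

theorem upperHaar_lt_minor_det_eq (m x N : ℕ) (hN : N ≤ x + 1) :
    (upperHaar p (m + 1)).real {z | (∃ y < N, ‖symDet (borderHom ℤ_[p] m z).2.2‖ =
        ((p : ℝ)⁻¹) ^ y) ∧ ‖symDet z‖ = ((p : ℝ)⁻¹) ^ x} =
      ∑ y ∈ Finset.range N, minorProb p m y * (((p : ℝ)⁻¹) ^ (x - y) * (1 - (p : ℝ)⁻¹)) := by
  have hsum : ∀ y ∈ Finset.range N,
      minorProb p m y * (((p : ℝ)⁻¹) ^ (x - y) * (1 - (p : ℝ)⁻¹)) =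
      (upperHaar p (m + 1)).real {z | ‖symDet (borderHom ℤ_[p] m z).2.2‖ =
        ((p : ℝ)⁻¹) ^ y ∧ ‖symDet z‖ = ((p : ℝ)⁻¹) ^ x} := by
    intro y hy
    rw [← upperHaar_minor_eq_det_eq, Nat.add_sub_cancel' (by have := Finset.mem_range.1 hy; omega)]
  rw [Finset.sum_congr rfl hsum, ← measureReal_biUnion_finset]
  · congr 1
    ext z
    simp only [Set.mem_iUnion, Set.mem_ofPred_eq, Finset.mem_range, exists_prop]
    exact ⟨fun ⟨⟨y, h1, h2⟩, h3⟩ => ⟨y, h1, h2, h3⟩, fun ⟨y, h1, h2, h3⟩ => ⟨⟨y, h1, h2⟩, h3⟩⟩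
  · intro i _ j _ hij
    refine Set.disjoint_left.2 fun w hi hj => hij ?_
    exact pow_right_injective₀ inv_prime_pos inv_prime_lt_one.ne (hi.1.symm.trans hj.1)
  · intro y _
    refine measurableSet_minor_det m (s := {q | q.1 = ((p : ℝ)⁻¹) ^ y ∧
      q.2 = ((p : ℝ)⁻¹) ^ x}) ?_
    measurability

theorem padicInt_pow_le_norm_iff (z : ℤ_[p]) (x : ℕ) :
    ((p : ℝ)⁻¹) ^ x ≤ ‖z‖ ↔ ∃ y < x + 1, ‖z‖ = ((p : ℝ)⁻¹) ^ y := by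
  constructor
  · intro h
    have hz : z ≠ 0 := by
      rintro rfl
      have := pow_pos (inv_prime_pos (p := p)) x
      rw [norm_zero] at h
      linarith
    refine ⟨z.valuation, ?_, padicInt_norm_eq_zpow hz⟩
    rw [padicInt_norm_eq_zpow hz] at h
    have := (pow_le_pow_iff_right_of_lt_one₀ inv_prime_pos inv_prime_lt_one).1 h
    omega
  · rintro ⟨y, hy, h⟩
    rw [h]
    exact pow_le_pow_of_le_one inv_prime_pos.le inv_prime_lt_one.le (by omega)

theorem padicInt_pow_lt_norm_iff (z : ℤ_[p]) (x : ℕ) :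
    ((p : ℝ)⁻¹) ^ x < ‖z‖ ↔ ∃ y < x, ‖z‖ = ((p : ℝ)⁻¹) ^ y := by
  rcases x with _ | x
  · simpa using PadicInt.norm_le_one z
  · rw [← padicInt_pow_le_norm_iff, ← not_le, ← padicInt_norm_lt_pow_iff, not_lt]

/-- An independent auxiliary border is attached to a matrix of size `l + 1`. Either its determinant
divides the adjugate form, which is the `minorProb` term, or the form is strictly larger; in that
case conditioning on the border replaces the form by `r ^ i` times the corner minor, whose valuation
`y` must satisfy `i + y < x`. -/
theorem detProb_eq_minorProb_add (l x : ℕ) :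
    detProb p (l + 1) x = minorProb p (l + 1) x +
      ∑ i ∈ Finset.range (x + 1), normSqProb p (l + 1) i * ∑ y ∈ Finset.range (x - i),
        minorProb p l y * (((p : ℝ)⁻¹) ^ (x - y) * (1 - (p : ℝ)⁻¹)) := by
  have hD : Continuous fun w : (Fin (l + 1) → ℤ_[p]) × UpperTriangle ℤ_[p] (l + 1) =>
    symDet w.2 := continuous_symDet.comp continuous_snd
  have hsum := borderHaar_eq_sum l x (p := p)
    (fun s d => ((p : ℝ)⁻¹) ^ x < s ∧ d = ((p : ℝ)⁻¹) ^ x) (by measurability) fun _ _ h => h.1.le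
  have hterm : ∀ i ∈ Finset.range (x + 1),
      (upperHaar p (l + 1)).real {z | ((p : ℝ)⁻¹) ^ x <
        ((p : ℝ)⁻¹) ^ i * ‖symDet (borderHom ℤ_[p] l z).2.2‖ ∧ ‖symDet z‖ = ((p : ℝ)⁻¹) ^ x} =
      ∑ y ∈ Finset.range (x - i),
        minorProb p l y * (((p : ℝ)⁻¹) ^ (x - y) * (1 - (p : ℝ)⁻¹)) := by
    intro i hi
    have hix : i ≤ x := Nat.lt_succ_iff.1 (Finset.mem_range.1 hi)
    rw [← upperHaar_lt_minor_det_eq l x (x - i) (by omega)]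
    congr 1
    ext z
    simp only [Set.mem_ofPred_eq, ← padicInt_pow_lt_norm_iff]
    refine and_congr_left fun _ => ?_
    conv_lhs => rw [← Nat.add_sub_cancel' hix, pow_add]
    exact mul_lt_mul_iff_right₀ (pow_pos inv_prime_pos i)
  have hdet : detProb p (l + 1) x =
      (borderHaar p (l + 1)).real {w | ‖symDet w.2‖ = ((p : ℝ)⁻¹) ^ x} := by
    rw [detProb, measureReal_def, measureReal_def,
      ← measurePreserving_snd (μ := vectorHaar p (l + 1)) |>.measure_preimage
        (isClosed_eq continuous_symDet.norm continuous_const).measurableSet.nullMeasurableSet]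
    rfl
  rw [hdet, minorProb_eq_borderHaar]
  have hrest : ∑ i ∈ Finset.range (x + 1), normSqProb p (l + 1) i * ∑ y ∈ Finset.range (x - i),
      minorProb p l y * (((p : ℝ)⁻¹) ^ (x - y) * (1 - (p : ℝ)⁻¹)) =
      (borderHaar p (l + 1)).real {w | ((p : ℝ)⁻¹) ^ x < ‖adjugateForm w‖ ∧
        ‖symDet w.2‖ = ((p : ℝ)⁻¹) ^ x} := by
    rw [hsum]
    refine Finset.sum_congr rfl fun i hi => ?_
    rw [hterm i hi, normSqProb]
  rw [hrest, ← measureReal_union]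
  · congr 1
    ext w
    simp only [Set.mem_union, Set.mem_ofPred_eq]
    constructor
    · intro h
      exact (le_or_gt ‖adjugateForm w‖ _).imp (fun h' => ⟨h, h'⟩) fun h' => ⟨h', h⟩
    · rintro (h | h)
      exacts [h.1, h.2]
  · exact Set.disjoint_left.2 fun w h h' => h'.1.not_ge h.2
  · exact (isOpen_lt continuous_const continuous_adjugateForm.norm).measurableSet.inter
      (isClosed_eq hD.norm continuous_const).measurableSet

theorem detProb_succ_eq_add_borderHaar (m x : ℕ) :
    detProb p (m + 1) x = ∑ y ∈ Finset.range (x + 1),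
        minorProb p m y * (((p : ℝ)⁻¹) ^ (x - y) * (1 - (p : ℝ)⁻¹)) +
      (borderHaar p m).real {w | ‖symDet w.2‖ < ((p : ℝ)⁻¹) ^ x ∧
        ‖adjugateForm w‖ = ((p : ℝ)⁻¹) ^ x} := by
  rw [← upperHaar_lt_minor_det_eq m x (x + 1) le_rfl, ← upperHaar_minor_lt_det_eq,
    ← measureReal_union]
  · rw [detProb]
    congr 1
    ext z
    simp only [Set.mem_union, Set.mem_ofPred_eq, ← padicInt_pow_le_norm_iff, ← or_and_right]
    exact ⟨fun h => ⟨le_or_gt _ _, h⟩, fun h => h.2⟩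
  · refine Set.disjoint_left.2 fun w h h' => ?_
    exact ((padicInt_pow_le_norm_iff _ _).2 h.1).not_gt h'.1
  · refine measurableSet_minor_det m (s := {q | q.1 < ((p : ℝ)⁻¹) ^ x ∧
      q.2 = ((p : ℝ)⁻¹) ^ x}) ?_
    measurability

/-- A minor of norm at least `r ^ x` divides the determinant with Haar quotient, which gives the
convolution. For a smaller minor the form must have norm `r ^ x`; after congruence this fixes the
inner minor at valuation `x - i`, and the strict bound on the outer one costs the factor `r ^ (i +
1)`. -/
theorem detProb_add_two_eq (l x : ℕ) :
    detProb p (l + 2) x = ∑ y ∈ Finset.range (x + 1),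
        minorProb p (l + 1) y * (((p : ℝ)⁻¹) ^ (x - y) * (1 - (p : ℝ)⁻¹)) +
      ∑ i ∈ Finset.range (x + 1), normSqProb p (l + 1) i *
        (((p : ℝ)⁻¹) ^ (i + 1) * minorProb p l (x - i)) := by
  rw [detProb_succ_eq_add_borderHaar]
  congr 1
  have hsum := borderHaar_eq_sum l x (p := p)
    (fun s d => d < ((p : ℝ)⁻¹) ^ x ∧ s = ((p : ℝ)⁻¹) ^ x) (by measurability) fun _ _ h => h.2.ge
  rw [hsum]
  refine Finset.sum_congr rfl fun i hi => ?_
  have hix : i ≤ x := Nat.lt_succ_iff.1 (Finset.mem_range.1 hi)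
  rw [normSqProb, ← upperHaar_minor_eq_det_lt, Nat.sub_add_cancel hix]
  congr 2
  ext z
  simp only [Set.mem_ofPred_eq]
  rw [and_comm]
  refine and_congr_left fun _ => ?_
  conv_lhs => rw [← Nat.add_sub_cancel' hix, pow_add]
  exact mul_right_inj' (pow_pos inv_prime_pos i).ne'

theorem symDet_fin_zero {R : Type*} [CommRing R] (x : UpperTriangle R 0) : symDet x = 1 := by
  simp [symDet]

theorem minorProb_zero (y : ℕ) : minorProb p 0 y = if y = 0 then 1 else 0 := by
  have h1 : (1 : ℝ) = ((p : ℝ)⁻¹) ^ y ↔ y = 0 := by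
    conv_lhs => rw [← pow_zero ((p : ℝ)⁻¹)]
    rw [(pow_right_injective₀ inv_prime_pos inv_prime_lt_one.ne).eq_iff, eq_comm]
  simp only [minorProb, symDet_fin_zero, norm_one, h1]
  split_ifs with hy
  · subst hy
    simp [PadicInt.norm_le_one]
  · simp [hy]

theorem detProb_one (x : ℕ) :
    detProb p 1 x = ((p : ℝ)⁻¹) ^ x * (1 - (p : ℝ)⁻¹) := by
  have := upperHaar_minor_eq_det_eq (p := p) 0 0 x
  simpa only [detProb, symDet_fin_zero, norm_one, pow_zero, true_and, zero_add, minorProb_zero,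
    if_true, one_mul] using this

theorem vectorHaar_closedBall (m j : ℕ) :
    (vectorHaar p m).real {c | ‖c‖ ≤ ((p : ℝ)⁻¹) ^ j} = ((p : ℝ)⁻¹) ^ (m * j) := by
  have : {c : Fin m → ℤ_[p] | ‖c‖ ≤ ((p : ℝ)⁻¹) ^ j} =
      Set.univ.pi fun _ => {a : ℤ_[p] | ‖a‖ ≤ ((p : ℝ)⁻¹) ^ j} := by
    ext c
    simp only [Set.mem_ofPred_eq, Set.mem_pi, Set.mem_univ, true_imp_iff]
    exact pi_norm_le_iff_of_nonneg (pow_nonneg inv_prime_pos.le j)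
  rw [this, measureReal_def, Measure.pi_pi, ENNReal.toReal_prod, Finset.prod_const,
    ← measureReal_def, padicIntHaar_real_closedBall_zero, Finset.card_univ, Fintype.card_fin,
    ← pow_mul, mul_comm]

theorem normSqProb_even (m j : ℕ) (hm : m ≠ 0) :
    normSqProb p m (2 * j) = ((p : ℝ)⁻¹) ^ (m * j) * (1 - ((p : ℝ)⁻¹) ^ m) := by
  obtain ⟨m, rfl⟩ := Nat.exists_eq_succ_of_ne_zero hm
  have hsplit : {c : Fin (m + 1) → ℤ_[p] | ‖c‖ ^ 2 = ((p : ℝ)⁻¹) ^ (2 * j)} =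
      {c | ‖c‖ ≤ ((p : ℝ)⁻¹) ^ j} \ {c | ‖c‖ ≤ ((p : ℝ)⁻¹) ^ (j + 1)} := by
    ext c
    rw [Set.mem_sdiff, Set.mem_ofPred_eq, Set.mem_ofPred_eq, Set.mem_ofPred_eq, mul_comm 2 j,
      pow_mul, pow_left_inj₀ (norm_nonneg c) (pow_nonneg inv_prime_pos.le j) two_ne_zero]
    by_cases hc : c = 0
    · have h0 := pow_pos (inv_prime_pos (p := p)) j
      have h1 := pow_pos (inv_prime_pos (p := p)) (j + 1)
      simp only [hc, norm_zero, h0.le, h1.le, h0.ne, not_true, and_false]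
    · obtain ⟨i, -, -, hi, -⟩ := padicInt_exists_eq_pow_smul_col c hc
      rw [hi, (pow_right_injective₀ inv_prime_pos inv_prime_lt_one.ne).eq_iff,
        pow_le_pow_iff_right_of_lt_one₀ inv_prime_pos inv_prime_lt_one,
        pow_le_pow_iff_right_of_lt_one₀ inv_prime_pos inv_prime_lt_one]
      omega
  rw [normSqProb, hsplit, measureReal_sdiff, vectorHaar_closedBall, vectorHaar_closedBall]
  · ring
  · intro c (hc : ‖c‖ ≤ _)
    exact hc.trans
      (pow_le_pow_of_le_one inv_prime_pos.le inv_prime_lt_one.le (Nat.le_succ j))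
  · exact (isClosed_le continuous_norm continuous_const).measurableSet

theorem normSqProb_odd (m j : ℕ) (hm : m ≠ 0) : normSqProb p m (2 * j + 1) = 0 := by
  obtain ⟨m, rfl⟩ := Nat.exists_eq_succ_of_ne_zero hm
  rw [normSqProb]
  convert measureReal_empty
  rw [Set.eq_empty_iff_forall_notMem]
  intro c hc
  rw [Set.mem_ofPred_eq] at hc
  by_cases hc0 : c = 0
  · have h0 := pow_pos (inv_prime_pos (p := p)) (2 * j + 1)
    rw [← hc, hc0] at h0
    simp at h0
  · obtain ⟨i, -, -, hi, -⟩ := padicInt_exists_eq_pow_smul_col c hc0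
    rw [hi, ← pow_mul] at hc
    have := pow_right_injective₀ inv_prime_pos inv_prime_lt_one.ne hc
    omega

end Distribution

end SymmetricHaarMatrices

/-! ### Algebraic identities that solve the recursion. -/

open PowerSeries in
theorem one_sub_C_mul_X_ne_zero (c : ℝ) : (1 - C c * X : ℝ⟦X⟧) ≠ 0 := by
  intro h
  simpa using congrArg constantCoeff h

theorem one_sub_C_mul_X_sq_ne_zero (c : ℝ) :
    (1 - PowerSeries.C c * PowerSeries.X ^ 2 : PowerSeries ℝ) ≠ 0 := by
  intro h
  simpa using congrArg PowerSeries.constantCoeff h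

section Algebra

variable {R : Type*} [CommRing R] [IsDomain R] {r a X G H A A' Z Z' : R}

/-- Here `a = r ^ n` with `n` odd. Eliminating `A` through `hinv` expresses `A'` (`s1`) and then
`Z'` (`s2`) by `Z`; comparing the two gives the relation of even type, with `a * r` for `a`.
Division is replaced by cancelling nonzero factors. -/
theorem recursion_step_odd (hG : (1 - r * X) * G = 1 - r)
    (hH : (1 - a * r ^ 2 * X ^ 2) * H = r * (1 - a)) (hA : A' = Z - X * G * H * A)
    (hZ : Z' = A' * G + H * A)
    (hinv : (1 - a) * (1 - r ^ 2 * X) * A = (1 - a * r * X) * (1 - r * X) * Z)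
    (ha : 1 - a ≠ 0) (h1 : 1 - r * X ≠ 0) (h2 : 1 - r ^ 2 * X ≠ 0)
    (h3 : 1 - a * r ^ 2 * X ^ 2 ≠ 0) :
    (1 - a * r ^ 2 * X ^ 2) * Z' = (1 - a * r ^ 2 * X) * Z ∧
    (1 - r ^ 2 * X) * (1 - a * r * r * X) * A' =
      (1 - a * r * r ^ 2 * X ^ 2) * (1 - r * X) * Z' := by
  have s1 : (1 - a * r ^ 2 * X ^ 2) * ((1 - a) * (1 - r ^ 2 * X)) * A' =
      (1 - a) * (1 - a * r ^ 3 * X ^ 2) * (1 - r * X) * Z := by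
    refine mul_left_cancel₀ h1 ?_
    linear_combination (1 - r * X) * (1 - a * r ^ 2 * X ^ 2) * ((1 - a) * (1 - r ^ 2 * X)) * hA -
      X * (hG * (1 - a * r ^ 2 * X ^ 2) * H * ((1 - a) * (1 - r ^ 2 * X)) * A +
        (1 - r) * hH * ((1 - a) * (1 - r ^ 2 * X)) * A + (1 - r) * r * (1 - a) * hinv)
  have s2 : (1 - a * r ^ 2 * X ^ 2) * Z' = (1 - a * r ^ 2 * X) * Z := by
    refine mul_left_cancel₀ (mul_ne_zero (mul_ne_zero h1 ha) h2) ?_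
    linear_combination (1 - r * X) * (1 - a * r ^ 2 * X ^ 2) * ((1 - a) * (1 - r ^ 2 * X)) * hZ +
      (1 - a * r ^ 2 * X ^ 2) * ((1 - a) * (1 - r ^ 2 * X)) * A' * hG + (1 - r) * s1 +
      (1 - r * X) * ((1 - a) * (1 - r ^ 2 * X)) * A * hH + (1 - r * X) * r * (1 - a) * hinv
  refine ⟨s2, mul_left_cancel₀ (mul_ne_zero h3 ha) ?_⟩
  linear_combination (1 - a * r ^ 2 * X) * s1 -
    (1 - a) * (1 - a * r ^ 3 * X ^ 2) * (1 - r * X) * s2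

/-- The same elimination from the even relation returns the odd one, so the two alternate. -/
theorem recursion_step_even (hG : (1 - r * X) * G = 1 - r)
    (hH : (1 - a * r ^ 2 * X ^ 2) * H = r * (1 - a)) (hA : A' = Z - X * G * H * A)
    (hZ : Z' = A' * G + H * A)
    (hinv : (1 - r ^ 2 * X) * (1 - a * r * X) * A = (1 - a * r ^ 2 * X ^ 2) * (1 - r * X) * Z)
    (h1 : 1 - r * X ≠ 0) (h2 : 1 - r ^ 2 * X ≠ 0) (h3 : 1 - a * r ^ 2 * X ^ 2 ≠ 0)
    (h4 : 1 - a * r * X ≠ 0) :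
    (1 - a * r * X) * Z' = (1 - a * r) * Z ∧
    (1 - a * r) * (1 - r ^ 2 * X) * A' = (1 - a * r * r * X) * (1 - r * X) * Z' := by
  have s1 : (1 - r ^ 2 * X) * (1 - a * r * X) * A' = (1 - r * X) * (1 - a * r ^ 2 * X) * Z := by
    refine mul_left_cancel₀ (mul_ne_zero h1 h3) ?_
    linear_combination (1 - r * X) * (1 - a * r ^ 2 * X ^ 2) *
      ((1 - r ^ 2 * X) * (1 - a * r * X)) * hA -
      X * (hG * (1 - a * r ^ 2 * X ^ 2) * H * ((1 - r ^ 2 * X) * (1 - a * r * X)) * A +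
        (1 - r) * hH * ((1 - r ^ 2 * X) * (1 - a * r * X)) * A + (1 - r) * r * (1 - a) * hinv)
  have s2 : (1 - a * r * X) * Z' = (1 - a * r) * Z := by
    refine mul_left_cancel₀ (mul_ne_zero (mul_ne_zero h1 h3) h2) ?_
    linear_combination (1 - r * X) * (1 - a * r ^ 2 * X ^ 2) *
      ((1 - r ^ 2 * X) * (1 - a * r * X)) * hZ +
      (1 - a * r ^ 2 * X ^ 2) * ((1 - r ^ 2 * X) * (1 - a * r * X)) * A' * hG +
      (1 - r) * (1 - a * r ^ 2 * X ^ 2) * s1 +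
      (1 - r * X) * ((1 - r ^ 2 * X) * (1 - a * r * X)) * A * hH +
      (1 - r * X) * r * (1 - a) * hinv
  refine ⟨s2, mul_left_cancel₀ h4 ?_⟩
  linear_combination (1 - a * r) * s1 - (1 - a * r * r * X) * (1 - r * X) * s2

end Algebra

/-! ### Generating functions and the relations between consecutive sizes. -/

section GeneratingFunctions

open PowerSeries

variable (p : ℕ)

/-- Generating function of the valuation of a Haar `p`-adic integer. -/
noncomputable def haarSeries : ℝ⟦X⟧ := mk fun u => ((p : ℝ)⁻¹) ^ u * (1 - (p : ℝ)⁻¹)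

theorem one_sub_mul_haarSeries :
    (1 - C ((p : ℝ)⁻¹) * X) * haarSeries p = 1 - C ((p : ℝ)⁻¹) := by
  ext k
  rw [sub_mul, one_mul, mul_assoc, map_sub, coeff_C_mul]
  rcases k with _ | k
  · simp [haarSeries]
  · simp [haarSeries, coeff_succ_X_mul, coeff_one]
    ring

variable [hp : Fact p.Prime]

/-- Generating function of `detProb`. -/
noncomputable def detSeries (n : ℕ) : ℝ⟦X⟧ := mk (detProb p n)

/-- Generating function of `minorProb`. -/
noncomputable def minorSeries (l : ℕ) : ℝ⟦X⟧ := mk (minorProb p l)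

/-- Generating function of twice the valuation of a Haar vector, evaluated at `X / p` and divided
by `p`. -/
noncomputable def normSqSeries (m : ℕ) : ℝ⟦X⟧ :=
  mk fun i => normSqProb p m i * ((p : ℝ)⁻¹) ^ (i + 1)

theorem one_sub_mul_normSqSeries (m : ℕ) (hm : m ≠ 0) :
    (1 - C (((p : ℝ)⁻¹) ^ m) * C ((p : ℝ)⁻¹) ^ 2 * X ^ 2) * normSqSeries p m =
      C ((p : ℝ)⁻¹) * (1 - C (((p : ℝ)⁻¹) ^ m)) := by
  have h : (1 - C (((p : ℝ)⁻¹) ^ m) * C ((p : ℝ)⁻¹) ^ 2 * X ^ 2) * normSqSeries p m =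
      normSqSeries p m - C (((p : ℝ)⁻¹) ^ (m + 2)) * (X ^ 2 * normSqSeries p m) := by
    rw [← map_pow, ← map_mul, ← pow_add]; ring
  have h' : C ((p : ℝ)⁻¹) * (1 - C (((p : ℝ)⁻¹) ^ m)) =
      C ((p : ℝ)⁻¹ * (1 - ((p : ℝ)⁻¹) ^ m)) := by simp
  rw [h, h']
  ext k
  rw [map_sub, coeff_C_mul, coeff_X_pow_mul', coeff_C]
  rcases Nat.even_or_odd' k with ⟨j, rfl | rfl⟩
  · rcases j with _ | j
    · have := normSqProb_even (p := p) m 0 hm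
      simp only [mul_zero, pow_zero, one_mul] at this
      simp [normSqSeries, coeff_mk, this]
      ring
    · rw [if_pos (by omega), if_neg (by omega), show 2 * (j + 1) - 2 = 2 * j by omega,
        normSqSeries, coeff_mk, coeff_mk, normSqProb_even _ _ hm, normSqProb_even _ _ hm]
      ring
  · rw [if_neg (by omega : 2 * j + 1 ≠ 0), normSqSeries, coeff_mk, normSqProb_odd _ _ hm]
    split_ifs with h2
    · rw [show 2 * j + 1 - 2 = 2 * (j - 1) + 1 by omega, coeff_mk, normSqProb_odd _ _ hm]
      ring
    · ring

/-- The strict inequality `i + y < x` accounts for the extra factor `X`: one writes `x = y + (i + 1)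
+ u` with `u` the exponent in `haarSeries`. -/
theorem minorSeries_succ (l : ℕ) :
    minorSeries p (l + 1) = detSeries p (l + 1) -
      X * haarSeries p * normSqSeries p (l + 1) * minorSeries p l := by
  rw [eq_sub_iff_add_eq, show X * haarSeries p * normSqSeries p (l + 1) * minorSeries p l =
    normSqSeries p (l + 1) * (X * (minorSeries p l * haarSeries p)) by ring]
  ext x
  rw [map_add, detSeries, coeff_mk, detProb_eq_minorProb_add, minorSeries, coeff_mk, coeff_mul,
    Finset.Nat.sum_antidiagonal_eq_sum_range_succ_mk]
  congr 1
  refine Finset.sum_congr rfl fun i hi => ?_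
  have hix : i ≤ x := Nat.lt_succ_iff.1 (Finset.mem_range.1 hi)
  obtain ⟨k, rfl⟩ := Nat.exists_eq_add_of_le hix
  rw [Nat.add_sub_cancel_left, normSqSeries, coeff_mk]
  rcases k with _ | k
  · simp
  · rw [coeff_succ_X_mul, coeff_mul, Finset.Nat.sum_antidiagonal_eq_sum_range_succ_mk, mul_assoc,
      Finset.mul_sum]
    congr 1
    refine Finset.sum_congr rfl fun y hy => ?_
    have hyk : y ≤ k := Nat.lt_succ_iff.1 (Finset.mem_range.1 hy)
    rw [minorSeries, haarSeries, coeff_mk, coeff_mk,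
      show i + (k + 1) - y = (i + 1) + (k - y) by omega, pow_add]
    ring

theorem detSeries_add_two (l : ℕ) :
    detSeries p (l + 2) = minorSeries p (l + 1) * haarSeries p +
      normSqSeries p (l + 1) * minorSeries p l := by
  ext x
  rw [map_add, detSeries, coeff_mk, detProb_add_two_eq, coeff_mul, coeff_mul,
    Finset.Nat.sum_antidiagonal_eq_sum_range_succ_mk,
    Finset.Nat.sum_antidiagonal_eq_sum_range_succ_mk]
  simp only [minorSeries, haarSeries, normSqSeries, coeff_mk, mul_assoc]

theorem minorSeries_zero : minorSeries p 0 = 1 := by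
  ext y
  rw [minorSeries, coeff_mk, minorProb_zero, coeff_one]

theorem detSeries_one : detSeries p 1 = haarSeries p := by
  ext y
  rw [detSeries, haarSeries, coeff_mk, coeff_mk, detProb_one]

variable {p}

theorem one_sub_C_inv_prime_pow_ne_zero (k : ℕ) (hk : k ≠ 0) :
    (1 - C (((p : ℝ)⁻¹) ^ k) : ℝ⟦X⟧) ≠ 0 := by
  intro h
  have h1 : 1 - ((p : ℝ)⁻¹) ^ k = 0 := by simpa using congrArg constantCoeff h
  exact (sub_pos.2 (pow_lt_one₀ inv_prime_pos.le inv_prime_lt_one hk)).ne' h1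

theorem detSeries_step_odd (l : ℕ)
    (hinv : (1 - C (((p : ℝ)⁻¹) ^ (l + 1))) * (1 - C ((p : ℝ)⁻¹) ^ 2 * X) * minorSeries p l =
      (1 - C (((p : ℝ)⁻¹) ^ (l + 1)) * C ((p : ℝ)⁻¹) * X) * (1 - C ((p : ℝ)⁻¹) * X) *
        detSeries p (l + 1)) :
    (1 - C (((p : ℝ)⁻¹) ^ (l + 3)) * X ^ 2) * detSeries p (l + 2) =
      (1 - C (((p : ℝ)⁻¹) ^ (l + 3)) * X) * detSeries p (l + 1) ∧
    (1 - C ((p : ℝ)⁻¹) ^ 2 * X) * (1 - C (((p : ℝ)⁻¹) ^ (l + 2)) * C ((p : ℝ)⁻¹) * X) *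
        minorSeries p (l + 1) =
      (1 - C (((p : ℝ)⁻¹) ^ (l + 2)) * C ((p : ℝ)⁻¹) ^ 2 * X ^ 2) * (1 - C ((p : ℝ)⁻¹) * X) *
        detSeries p (l + 2) := by
  have h := recursion_step_odd (r := C ((p : ℝ)⁻¹)) (a := C (((p : ℝ)⁻¹) ^ (l + 1))) (X := X)
    (G := haarSeries p) (H := normSqSeries p (l + 1)) (A := minorSeries p l)
    (A' := minorSeries p (l + 1)) (Z := detSeries p (l + 1)) (Z' := detSeries p (l + 2))
    (one_sub_mul_haarSeries p)
    (one_sub_mul_normSqSeries p (l + 1) (by omega)) (minorSeries_succ p l)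
    (detSeries_add_two p l) hinv (one_sub_C_inv_prime_pow_ne_zero _ (by omega))
    (one_sub_C_mul_X_ne_zero _)
    (by rw [← map_pow]; exact one_sub_C_mul_X_ne_zero _)
    (by rw [← map_pow, ← map_mul]; exact one_sub_C_mul_X_sq_ne_zero _)
  have e2 : C (((p : ℝ)⁻¹) ^ (l + 2)) = C (((p : ℝ)⁻¹) ^ (l + 1)) * C ((p : ℝ)⁻¹) := by
    rw [pow_succ, map_mul]
  have e3 : C (((p : ℝ)⁻¹) ^ (l + 3)) = C (((p : ℝ)⁻¹) ^ (l + 1)) * C ((p : ℝ)⁻¹) ^ 2 := by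
    rw [← map_pow, ← map_mul, ← pow_add]
  rw [e2, e3]
  exact h

theorem detSeries_step_even (l : ℕ)
    (hinv : (1 - C ((p : ℝ)⁻¹) ^ 2 * X) * (1 - C (((p : ℝ)⁻¹) ^ (l + 1)) * C ((p : ℝ)⁻¹) * X) *
        minorSeries p l =
      (1 - C (((p : ℝ)⁻¹) ^ (l + 1)) * C ((p : ℝ)⁻¹) ^ 2 * X ^ 2) * (1 - C ((p : ℝ)⁻¹) * X) *
        detSeries p (l + 1)) :
    (1 - C (((p : ℝ)⁻¹) ^ (l + 2)) * X) * detSeries p (l + 2) =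
      (1 - C (((p : ℝ)⁻¹) ^ (l + 2))) * detSeries p (l + 1) ∧
    (1 - C (((p : ℝ)⁻¹) ^ (l + 2))) * (1 - C ((p : ℝ)⁻¹) ^ 2 * X) * minorSeries p (l + 1) =
      (1 - C (((p : ℝ)⁻¹) ^ (l + 2)) * C ((p : ℝ)⁻¹) * X) * (1 - C ((p : ℝ)⁻¹) * X) *
        detSeries p (l + 2) := by
  have h := recursion_step_even (r := C ((p : ℝ)⁻¹)) (a := C (((p : ℝ)⁻¹) ^ (l + 1))) (X := X)
    (G := haarSeries p) (H := normSqSeries p (l + 1)) (A := minorSeries p l)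
    (A' := minorSeries p (l + 1)) (Z := detSeries p (l + 1)) (Z' := detSeries p (l + 2))
    (one_sub_mul_haarSeries p)
    (one_sub_mul_normSqSeries p (l + 1) (by omega)) (minorSeries_succ p l)
    (detSeries_add_two p l) hinv (one_sub_C_mul_X_ne_zero _)
    (by rw [← map_pow]; exact one_sub_C_mul_X_ne_zero _)
    (by rw [← map_pow, ← map_mul]; exact one_sub_C_mul_X_sq_ne_zero _)
    (by rw [← map_mul]; exact one_sub_C_mul_X_ne_zero _)
  have e2 : C (((p : ℝ)⁻¹) ^ (l + 2)) = C (((p : ℝ)⁻¹) ^ (l + 1)) * C ((p : ℝ)⁻¹) := by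
    rw [pow_succ, map_mul]
  rw [e2]
  exact h

/-- This is the invariant of the recursion; it starts from `A 0 = 1`, `Z 1 = G` and is carried from
one odd size to the next by an odd and an even step. -/
theorem minorSeries_odd (m : ℕ) :
    (1 - C (((p : ℝ)⁻¹) ^ (2 * m + 1))) * (1 - C ((p : ℝ)⁻¹) ^ 2 * X) * minorSeries p (2 * m) =
      (1 - C (((p : ℝ)⁻¹) ^ (2 * m + 1)) * C ((p : ℝ)⁻¹) * X) * (1 - C ((p : ℝ)⁻¹) * X) *
        detSeries p (2 * m + 1) := by
  induction m with
  | zero =>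
    simp only [mul_zero, zero_add, pow_one, minorSeries_zero, detSeries_one]
    linear_combination -(1 - C ((p : ℝ)⁻¹) * C ((p : ℝ)⁻¹) * X) * one_sub_mul_haarSeries p
  | succ m ih => exact (detSeries_step_even _ (detSeries_step_odd _ ih).2).2

/-- The generating function for matrices of even size in terms of the preceding odd size. -/
theorem detSeries_even (m : ℕ) :
    (1 - C (((p : ℝ)⁻¹) ^ (2 * m + 3)) * X ^ 2) * detSeries p (2 * m + 2) =
      (1 - C (((p : ℝ)⁻¹) ^ (2 * m + 3)) * X) * detSeries p (2 * m + 1) :=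
  (detSeries_step_odd _ (minorSeries_odd m)).1

/-- The generating function for matrices of odd size in terms of the preceding even size. -/
theorem detSeries_odd (m : ℕ) :
    (1 - C (((p : ℝ)⁻¹) ^ (2 * m + 3)) * X) * detSeries p (2 * m + 3) =
      (1 - C (((p : ℝ)⁻¹) ^ (2 * m + 3))) * detSeries p (2 * m + 2) :=
  (detSeries_step_even _ (detSeries_step_odd _ (minorSeries_odd m)).2).1

/-- The generating function for matrices of odd size in terms of the preceding odd size. -/
theorem detSeries_odd_odd (m : ℕ) :
    (1 - C (((p : ℝ)⁻¹) ^ (2 * m + 3)) * X ^ 2) * detSeries p (2 * m + 3) =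
      (1 - C (((p : ℝ)⁻¹) ^ (2 * m + 3))) * detSeries p (2 * m + 1) := by
  refine mul_left_cancel₀ (one_sub_C_mul_X_ne_zero (((p : ℝ)⁻¹) ^ (2 * m + 3))) ?_
  linear_combination (1 - C (((p : ℝ)⁻¹) ^ (2 * m + 3)) * X ^ 2) * detSeries_odd (p := p) m +
    (1 - C (((p : ℝ)⁻¹) ^ (2 * m + 3))) * detSeries_even (p := p) m

end GeneratingFunctions

/-! ### Uniform bounds for the error term. -/

section Estimates

variable {p : ℕ} [hp : Fact p.Prime]

/-- The deviation of the distribution of the valuation of the determinant from its main term. -/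
noncomputable def detError (p : ℕ) [Fact p.Prime] (n k : ℕ) : ℝ :=
  detProb p n k - ((p : ℝ)⁻¹) ^ k * (1 - ((p : ℝ)⁻¹) ^ n)

theorem detError_one (k : ℕ) : detError p 1 k = 0 := by
  rw [detError, detProb_one]; ring

theorem detProb_odd_odd (m k : ℕ) :
    detProb p (2 * m + 3) k -
      ((p : ℝ)⁻¹) ^ (2 * m + 3) * (if 2 ≤ k then detProb p (2 * m + 3) (k - 2) else 0) =
    (1 - ((p : ℝ)⁻¹) ^ (2 * m + 3)) * detProb p (2 * m + 1) k := by
  have h := congrArg (PowerSeries.coeff k) (detSeries_odd_odd (p := p) m)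
  rw [sub_mul, sub_mul, one_mul, one_mul, mul_assoc, map_sub, map_sub, PowerSeries.coeff_C_mul,
    PowerSeries.coeff_C_mul, PowerSeries.coeff_X_pow_mul'] at h
  simp only [detSeries, PowerSeries.coeff_mk] at h
  rw [h]; ring

theorem detProb_even_odd (m k : ℕ) :
    (1 - ((p : ℝ)⁻¹) ^ (2 * m + 3)) * detProb p (2 * m + 2) k =
      detProb p (2 * m + 3) k -
        ((p : ℝ)⁻¹) ^ (2 * m + 3) * (if 1 ≤ k then detProb p (2 * m + 3) (k - 1) else 0) := by
  have h := congrArg (PowerSeries.coeff k) (detSeries_odd (p := p) m)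
  rw [← pow_one PowerSeries.X, sub_mul, sub_mul, one_mul, one_mul, mul_assoc, map_sub, map_sub,
    PowerSeries.coeff_C_mul, PowerSeries.coeff_C_mul, PowerSeries.coeff_X_pow_mul'] at h
  simp only [detSeries, PowerSeries.coeff_mk] at h
  rw [h]; ring

/-- The main term satisfies `detProb_odd_odd` exactly for `k ≥ 2`, so new error enters only at `k =
0, 1`. Two steps in `k` cost `w ^ 2 = r ^ 3`, which the coefficient `r ^ (2m+3)` pays for. The
factor `2 * (1 - (1 / 4) ^ m)` leaves room for the growth at each `m` while staying below `2`. -/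
theorem abs_detError_odd_le (hp2 : p ≠ 2) {w : ℝ} (hw : 0 < w) (hw2 : w ^ 2 = ((p : ℝ)⁻¹) ^ 3)
    (m k : ℕ) : |detError p (2 * m + 1) k| ≤ 2 * (1 - (1 / 4) ^ m) * w ^ k := by
  have hr0 := inv_prime_pos (p := p)
  have hr1 := inv_prime_lt_one (p := p)
  have hr3 : (p : ℝ)⁻¹ ≤ 1 / 3 := by
    have : (3 : ℝ) ≤ p := by
      have := hp.out.two_le
      exact_mod_cast (by omega : 3 ≤ p)
    rw [one_div]
    exact inv_anti₀ (by norm_num) this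
  have hrw : ((p : ℝ)⁻¹) ^ 2 ≤ w := by
    refine le_of_sq_le_sq ?_ hw.le
    rw [hw2, ← pow_mul]
    exact pow_le_pow_of_le_one hr0.le hr1.le (by norm_num)
  induction m generalizing k with
  | zero => simp [detError_one]
  | succ m ih =>
    have hδ9 : ((p : ℝ)⁻¹) ^ (2 * m) ≤ (1 / 9) ^ m := by
      rw [pow_mul]
      refine pow_le_pow_left₀ (by positivity) ?_ m
      nlinarith
    have hy0 : (0 : ℝ) < (1 / 4) ^ m := by positivity
    have hy1 : ((1 : ℝ) / 4) ^ m ≤ 1 := pow_le_one₀ (by norm_num) (by norm_num)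
    have hδ0 : 0 < ((p : ℝ)⁻¹) ^ (2 * m) := by positivity
    -- The allowed constant grows by `3 / 2 * (1 / 4) ^ m` from `m` to `m + 1`. The first bound, an
    -- equality at `m = 0`, serves `k ≥ 2`; the second serves `k = 0, 1`.
    have hδ : ((p : ℝ)⁻¹) ^ (2 * m) * (1 - (1 / 4) ^ m / 4) ≤ 3 / 4 * (1 / 4) ^ m ∧
        ((p : ℝ)⁻¹) ^ (2 * m) ≤ 3 / 2 * (1 / 4) ^ m := by
      rcases m with _ | m
      · norm_num
      · have h1 : ((1 : ℝ) / 9) ^ (m + 1) ≤ 4 / 9 * (1 / 4) ^ (m + 1) := by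
          have : ((1 : ℝ) / 9) ^ m ≤ (1 / 4) ^ m := pow_le_pow_left₀ (by norm_num) (by norm_num) m
          rw [pow_succ, pow_succ]
          linarith
        constructor <;> nlinarith
    set δ := ((p : ℝ)⁻¹) ^ (2 * m) with hδdef
    set r := (p : ℝ)⁻¹ with hr
    set y : ℝ := (1 / 4) ^ m with hydef
    have hc : r ^ (2 * m + 3) = δ * r ^ 3 := by rw [hδdef, ← pow_add]
    have hn : r ^ (2 * m + 1) = δ * r := by rw [hδdef, ← pow_succ]
    have hδ1 : δ ≤ 1 := pow_le_one₀ hr0.le hr1.le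
    have hc0 : 0 ≤ 1 - δ * r ^ 3 := by
      have : δ * r ^ 3 ≤ 1 := mul_le_one₀ hδ1 (by positivity) (pow_le_one₀ hr0.le hr1.le)
      linarith
    have hc1 : 1 - δ * r ^ 3 ≤ 1 := by
      have : 0 ≤ δ * r ^ 3 := by positivity
      linarith
    rw [pow_succ, ← hydef, show 2 * (m + 1) + 1 = 2 * m + 3 by ring]
    induction k using Nat.strong_induction_on with
    | _ k ihk =>
      have hrec := detProb_odd_odd (p := p) m k
      have hmain := ih k
      have hcases : k = 0 ∨ k = 1 ∨ 2 ≤ k := by omega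
      rcases hcases with rfl | rfl | hk
      -- With no term at `k - 2`, the main term misses the recurrence by `r ^ (2m+1) = δ * r`, times
      -- `1 - δ * r ^ 3`.
      · have he : detError p (2 * m + 3) 0 =
            (1 - δ * r ^ 3) * (detError p (2 * m + 1) 0 - δ * r) := by
          simp only [detError, ← hr, hc, hn] at hrec ⊢
          simp only [nonpos_iff_eq_zero, OfNat.ofNat_ne_zero, if_false] at hrec
          linear_combination hrec
        rw [he, abs_mul, abs_of_nonneg hc0]
        refine (mul_le_of_le_one_left (abs_nonneg _) hc1).trans ((abs_sub _ _).trans ?_)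
        rw [abs_of_pos (by positivity : 0 < δ * r)]
        have : δ * r ≤ δ := mul_le_of_le_one_right hδ0.le hr1.le
        simp only [pow_zero, mul_one] at hmain ⊢
        linarith [hδ.2]
      · have he : detError p (2 * m + 3) 1 =
            (1 - δ * r ^ 3) * (detError p (2 * m + 1) 1 - δ * r ^ 2) := by
          simp only [detError, ← hr, hc, hn] at hrec ⊢
          simp only [Nat.not_ofNat_le_one, if_false] at hrec
          linear_combination hrec
        rw [he, abs_mul, abs_of_nonneg hc0]
        refine (mul_le_of_le_one_left (abs_nonneg _) hc1).trans ((abs_sub _ _).trans ?_)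
        rw [abs_of_pos (by positivity : 0 < δ * r ^ 2)]
        have h1 : δ * r ^ 2 ≤ δ * w := mul_le_mul_of_nonneg_left hrw hδ0.le
        have h2 : δ * w ≤ 3 / 2 * y * w := mul_le_mul_of_nonneg_right hδ.2 hw.le
        simp only [pow_one] at hmain ⊢
        linarith
      · obtain ⟨k, rfl⟩ := Nat.exists_eq_add_of_le' hk
        have he : detError p (2 * m + 3) (k + 2) =
            δ * r ^ 3 * detError p (2 * m + 3) k +
              (1 - δ * r ^ 3) * detError p (2 * m + 1) (k + 2) := by
          simp only [detError, ← hr, hc, hn] at hrec ⊢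
          rw [if_pos hk, Nat.add_sub_cancel] at hrec
          linear_combination hrec
        have h1 : |detError p (2 * m + 3) k| ≤ 2 * (1 - y * (1 / 4)) * w ^ k :=
          ihk k (by omega)
        have h2 : δ * r ^ 3 * |detError p (2 * m + 3) k| ≤
            δ * (2 * (1 - y * (1 / 4))) * w ^ (k + 2) := by
          rw [pow_add, hw2]
          have := mul_le_mul_of_nonneg_left h1 (by positivity : 0 ≤ δ * r ^ 3)
          linarith
        have h3 : (1 - δ * r ^ 3) * |detError p (2 * m + 1) (k + 2)| ≤
            2 * (1 - y) * w ^ (k + 2) :=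
          (mul_le_of_le_one_left (abs_nonneg _) hc1).trans hmain
        have h4 : (δ * (2 * (1 - y * (1 / 4))) + 2 * (1 - y)) * w ^ (k + 2) ≤
            2 * (1 - y * (1 / 4)) * w ^ (k + 2) :=
          mul_le_mul_of_nonneg_right (by linarith [hδ.1]) (by positivity)
        rw [he]
        refine (abs_add_le _ _).trans ?_
        rw [abs_mul (δ * r ^ 3), abs_mul (1 - δ * r ^ 3), abs_of_nonneg hc0,
          abs_of_pos (by positivity : 0 < δ * r ^ 3)]
        linarith

theorem abs_detError_le (hp2 : p ≠ 2) {w : ℝ} (hw : 0 < w) (hw2 : w ^ 2 = ((p : ℝ)⁻¹) ^ 3)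
    (n : ℕ) (hn : n ≠ 0) (k : ℕ) : |detError p n k| ≤ 8 * w ^ k := by
  have hodd (m k : ℕ) : |detError p (2 * m + 1) k| ≤ 2 * w ^ k := by
    refine (abs_detError_odd_le hp2 hw hw2 m k).trans
      (mul_le_mul_of_nonneg_right ?_ (by positivity))
    have : (0 : ℝ) < (1 / 4) ^ m := by positivity
    linarith
  rcases Nat.even_or_odd' n with ⟨m, rfl | rfl⟩
  · obtain ⟨m, rfl⟩ := Nat.exists_eq_succ_of_ne_zero (show m ≠ 0 by omega)
    rw [show 2 * m.succ = 2 * m + 2 by omega]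
    have hr0 := inv_prime_pos (p := p)
    have hr1 := inv_prime_lt_one (p := p)
    have hr2 : (p : ℝ)⁻¹ ≤ 1 / 2 := by
      rw [one_div]
      exact inv_anti₀ (by norm_num) (by exact_mod_cast hp.out.two_le)
    set c := ((p : ℝ)⁻¹) ^ (2 * m + 3) with hc
    have hcr : c ≤ (p : ℝ)⁻¹ := pow_le_of_le_one hr0.le hr1.le (by omega)
    have hc0 : 0 < c := by positivity
    have hcw : c ≤ w ^ 2 := by
      rw [hw2]
      exact pow_le_pow_of_le_one hr0.le hr1.le (by omega)
    have hw1 : w < 1 := by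
      refine lt_of_pow_lt_pow_left₀ 2 zero_le_one ?_
      rw [hw2, one_pow]
      exact pow_lt_one₀ hr0.le hr1 (by norm_num)
    have hrec := detProb_even_odd (p := p) m k
    have hk := hodd (m + 1) k
    rw [show 2 * (m + 1) + 1 = 2 * m + 3 by ring] at hk
    -- Even sizes are read off from the next odd size: two errors of at most `2 * w ^ k` each, and
    -- `1 - c ≥ 1 / 2` turns `4` into `8`.
    suffices h : (1 - c) * |detError p (2 * m + 2) k| ≤ 4 * w ^ k by
      have := mul_le_mul_of_nonneg_right (show 1 / 2 ≤ 1 - c by linarith)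
        (abs_nonneg (detError p (2 * m + 2) k))
      linarith
    have hc1 : 0 ≤ 1 - c := by linarith
    rw [← abs_of_nonneg hc1, ← abs_mul]
    rcases k with _ | k
    · have he : (1 - c) * detError p (2 * m + 2) 0 =
          detError p (2 * m + 3) 0 + (1 - c) * ((p : ℝ)⁻¹) ^ (2 * m + 2) := by
        simp only [detError, ← hc] at hrec ⊢
        simp only [nonpos_iff_eq_zero, one_ne_zero, if_false] at hrec
        linear_combination hrec
      have h1 : ((p : ℝ)⁻¹) ^ (2 * m + 2) ≤ 1 := pow_le_one₀ hr0.le hr1.le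
      rw [he]
      refine (abs_add_le _ _).trans ?_
      rw [abs_mul, abs_of_nonneg hc1, abs_of_nonneg (pow_nonneg hr0.le (2 * m + 2))]
      have := mul_le_one₀ (by linarith : 1 - c ≤ 1) (pow_nonneg hr0.le (2 * m + 2)) h1
      simp only [pow_zero] at hk ⊢
      linarith
    · have he : (1 - c) * detError p (2 * m + 2) (k + 1) =
          detError p (2 * m + 3) (k + 1) - c * detError p (2 * m + 3) k := by
        simp only [detError, ← hc] at hrec ⊢
        rw [if_pos (by omega), Nat.add_sub_cancel] at hrec
        have hcn : c = ((p : ℝ)⁻¹) ^ (2 * m + 2) * (p : ℝ)⁻¹ := by rw [hc, ← pow_succ]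
        linear_combination hrec + ((p : ℝ)⁻¹) ^ k * (1 - c) * hcn
      have h2 := hodd (m + 1) k
      rw [show 2 * (m + 1) + 1 = 2 * m + 3 by ring] at h2
      rw [he]
      refine (abs_sub _ _).trans ?_
      rw [abs_mul, abs_of_pos hc0]
      have h3 : c * |detError p (2 * m + 3) k| ≤ w * (2 * w ^ k) :=
        mul_le_mul (hcw.trans (pow_le_of_le_one hw.le hw1.le two_ne_zero)) h2 (abs_nonneg _) hw.le
      rw [pow_succ] at hk ⊢
      linarith
  · exact (hodd m k).trans (mul_le_mul_of_nonneg_right (by norm_num) (by positivity))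

end Estimates

/-! ### Transfer to an arbitrary probability space and conclusion. -/

/-- The distribution of the determinant of any Haar symmetric matrix is the one computed in
coordinates. -/
theorem IsHaarSymmetricMatrix.real_norm_det_eq {Ω : Type*} [MeasurableSpace Ω] {P : Measure Ω}
    [IsProbabilityMeasure P] {p : ℕ} [Fact p.Prime] {n : ℕ}
    {X : Ω → Matrix (Fin n) (Fin n) ℤ_[p]} (hX : IsHaarSymmetricMatrix P p n X) (k : ℕ) :
    P.real {ω | ‖(X ω).det‖ = (p : ℝ) ^ (-(k : ℤ))} = detProb p n k := by
  have hlaw (e : {e : Fin n × Fin n // e.1 ≤ e.2}) := hX.hasLaw e.1.1 e.1.2 e.2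
  have hae (e : {e : Fin n × Fin n // e.1 ≤ e.2}) :
      AEMeasurable (fun ω => X ω e.1.1 e.1.2) P := (hlaw e).aemeasurable
  have hmap := (iIndepFun_iff_map_fun_eq_pi_map hae).1 hX.indep
  simp only [fun e => (hlaw e).map_eq] at hmap
  have hset : MeasurableSet {x : UpperTriangle ℤ_[p] n | ‖symDet x‖ = ((p : ℝ)⁻¹) ^ k} :=
    (isClosed_eq continuous_symDet.norm continuous_const).measurableSet
  rw [detProb, upperHaar, measureReal_def, measureReal_def, ← hmap,
    Measure.map_apply_of_aemeasurable (aemeasurable_pi_lambda _ hae) hset]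
  congr 2
  ext ω
  have h : symDet (fun e : {e : Fin n × Fin n // e.1 ≤ e.2} => X ω e.1.1 e.1.2) = (X ω).det :=
    congrArg Matrix.det (symMatrix_upperTriangle (hX.isSymm ω))
  rw [Set.mem_preimage, Set.mem_ofPred_eq, Set.mem_ofPred_eq, h, zpow_neg, zpow_natCast, inv_pow]

theorem mainTheorem8 :
    ∃ C : ℝ, 0 < C ∧
      ∀ (p : ℕ) [Fact p.Prime], p ≠ 2 →
      ∀ n : ℕ, 1 ≤ n → ∀ k : ℕ,
      ∀ (Ω : Type*) [MeasurableSpace Ω] (P : Measure Ω) [IsProbabilityMeasure P]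
        (X : Ω → Matrix (Fin n) (Fin n) ℤ_[p]),
        IsHaarSymmetricMatrix P p n X →
        |P.real {ω | ‖(X ω).det‖ = (p : ℝ) ^ (-(k : ℤ))}
            - (p : ℝ) ^ (-(k : ℤ)) * (1 - (p : ℝ) ^ (-(n : ℤ)))|
          ≤ C * (p : ℝ) ^ (-(3 * (k : ℝ) / 2)) := by
  refine ⟨8, by norm_num, fun p hp hp2 n hn k Ω _ P _ X hX => ?_⟩
  have hp0 : (0 : ℝ) < p := by exact_mod_cast hp.out.pos
  have hw2 : ((p : ℝ) ^ (-(3 / 2) : ℝ)) ^ 2 = ((p : ℝ)⁻¹) ^ 3 := by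
    rw [← Real.rpow_mul_natCast hp0.le, inv_pow, ← Real.rpow_natCast, ← Real.rpow_neg hp0.le]
    norm_num
  have h := abs_detError_le hp2 (Real.rpow_pos_of_pos hp0 _) hw2 n (by omega) k
  rw [← Real.rpow_mul_natCast hp0.le, show -(3 / 2 : ℝ) * k = -(3 * (k : ℝ) / 2) by ring,
    detError, inv_pow, inv_pow] at h
  rwa [hX.real_norm_det_eq, zpow_neg, zpow_natCast, zpow_neg, zpow_natCast]
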